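/- Let $G=LSL_2=SL_2(\mathbb C((s)))$ and $\mathfrak g=L\mathfrak{sl}_2=\mathfrak{sl}_2(\mathbb C((s)))$, with $E_n=Es^n$, $H_n=Hs^n$, $F_n=Fs^n$ for the standard basis $E,H,F$ of $\mathfrak{sl}_2$. Let $q\in\mathbb C^\times$ and let $\tau$ denote the automorphisms $g(s)\mapsto g(sq)$ of $G$ and $\xi(s)\mapsto\xi(sq)$ of $\mathfrak g$. Let $(\phi_n)_{n\in\mathbb Z}$ be complex numbers with $\phi_n+\phi_{-n}=1$ for all $n$, and put $$r=\sum_{n\in\mathbb Z}E_n\otimes F_{-n}+\tfrac12\sum_{n\in\mathbb Z}\phi_n\,H_n\otimes H_{-n}.$$ *Functionals.* Let $R$ be the algebra of functionals $G\to\mathbb C$ that are finite linear combinations of expressions $\sum_{m_1+\dots+m_k=M}c(m_1,\dots,m_k)\,x_{e_1,m_1}\cdots x_{e_k,m_k}$, where $x_{e,m}$ is the $m$-th Fourier coefficient of the matrix entry of $x$ at position $e$, and the $c(m_1,\dots,m_k)\in\mathbb C$ are arbitrary (at each $x$ only finitely many terms are non-zero). For a functional $f$ on $G$, the left and right gradients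 at $x$ are the $s$-adically continuous linear functionals on $\mathfrak g$ with $\langle\nabla f(x),\xi\rangle=\frac{d}{dt}f(e^{t\xi}x)|_{t=0}$ and $\langle\nabla' f(x),\xi\rangle=\frac{d}{dt}f(xe^{t\xi})|_{t=0}$, where $e^{t\xi}$ stands for an arbitrary curve $\gamma(t)=1+t\xi+O(t^2)$ in $G$ that is polynomial in $t$, and the derivative has to exist for all of these and depend only on $\xi$. Call $f$ differentiable if both gradients exist at every $x$. *Brackets.* With $a\wedge b=(a\otimes b-b\otimes a)/2$, define for differentiable $f,h$ $$\eta:\quad \{f,h\}=\langle r,\nabla f\wedge\nabla h-\nabla' f\wedge\nabla' h\rangle,$$ $$\eta_*^q:\quad \{f,h\}=\langle r,\nabla f\wedge\nabla h+\nabla' f\wedge\nabla' h\rangle-\langle(\mathrm{id}\otimes\tau)(r),\nabla' f\otimes\nabla h-\nabla' h\otimes\nabla f\rangle.$$ On a product of two copies of $G$ with brackets, the product bracket is the sum of the brackets taken in each variable separately. A map $a$ from such a product to $G$ with a bracket is Poisson if for all differentiable $f$ the pull-back $f\circ a$ is differentiable in each variable, and $\{f\circ a,h\circ a\}=\{f,h\}\circ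 a$ for all differentiable $f,h$. **Proposition.** All functionals in $R$ are differentiable, and: (1) $(LSL_2,\eta)$ is a Poisson–Lie group: $\eta$ is a Poisson bracket on $R$ (it maps $R\times R$ to $R$, is bilinear and skew-symmetric, and satisfies the Leibniz rule and the Jacobi identity), and the multiplication $(G,\eta)\times(G,\eta)\to(G,\eta)$ is a Poisson map. Likewise $\eta_*^q$ is a Poisson bracket on $R$; write $M_{2,q}=G$ with this bracket. The $q$-gauge transformations $g(s)\cdot M(s)=g(sq)\,M(s)\,g(s)^{-1}$ are an action of $LSL_2$ on $M_{2,q}$, and this action is Poisson, i.e. $(LSL_2,\eta)\times(M_{2,q},\eta_*^q)\to(M_{2,q},\eta_*^q)$, $(g,M)\mapsto g\cdot M$, is a Poisson map. (2) The subgroup $LN=\left\{\begin{pmatrix}1&x(s)\\0&1\end{pmatrix}\right\}\subset LSL_2$ is admissible: the $LN$-invariant functionals in $R$ form a Poisson subalgebra of $(R,\eta_*^q)$. -/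

import Mathlib

noncomputable section

namespace QLoop

/-! ### Loop group and loop algebra -/

/-- The field `ℂ((s))` of formal Laurent series. -/
abbrev Loop : Type := LaurentSeries ℂ

/-- The loop group `LSL₂ = SL₂(ℂ((s)))`. -/
abbrev LSL2 : Type := Matrix.SpecialLinearGroup (Fin 2) Loop

/-- The loop algebra `Lsl₂ = sl₂(ℂ((s)))` of traceless matrices, as a complex vector space. -/
abbrev Lsl2 : Type := LinearMap.ker (Matrix.traceLinearMap (Fin 2) ℂ Loop)

theorem trace_eq_zero_of_mem (ξ : Lsl2) : ξ.1 0 0 + ξ.1 1 1 = 0 := by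
  have h : Matrix.trace ξ.1 = 0 := ξ.2
  simpa [Matrix.trace_fin_two] using h

/-- The traceless matrix with upper right entry `e`, diagonal `(h, -h)`, lower left entry `f`. -/
def slMk (e h f : Loop) : Lsl2 :=
  ⟨!![h, e; f, -h], by simp [Matrix.trace_fin_two]⟩

/-- The monomial `s ^ n`. -/
def mono (n : ℤ) : Loop := HahnSeries.single n (1 : ℂ)

/-- `E_n = E s^n`. -/
def slE (n : ℤ) : Lsl2 := slMk (mono n) 0 0

/-- `H_n = H s^n`. -/
def slH (n : ℤ) : Lsl2 := slMk 0 (mono n) 0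

/-- `F_n = F s^n`. -/
def slF (n : ℤ) : Lsl2 := slMk 0 0 (mono n)

/-- The automorphism `a(s) ↦ a(sq)` of `ℂ((s))`, which multiplies the `n`-th coefficient
by `q ^ n`. -/
def qShift (q : ℂˣ) : Loop →+* Loop where
  toFun a :=
    { coeff := fun n => (q : ℂ) ^ n * a.coeff n
      isPWO_support' := a.isPWO_support.mono fun n hn => by
        simp only [Function.mem_support, ne_eq, mul_eq_zero, not_or] at hn
        exact hn.2 }
  map_one' := by
    ext n
    by_cases hn : n = 0 <;> simp [HahnSeries.coeff_one, hn]
  map_zero' := by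
    ext n
    simp
  map_add' a b := by
    ext n
    simp [mul_add]
  map_mul' a b := by
    ext n
    have hq : (q : ℂ) ≠ 0 := q.ne_zero
    rw [HahnSeries.coeff_mul]
    change (q : ℂ) ^ n * (a * b).coeff n = _
    rw [HahnSeries.coeff_mul, Finset.mul_sum]
    refine Finset.sum_congr ?_ ?_
    · ext ij
      simp [zpow_ne_zero _ hq]
    · intro ij hij
      rw [Finset.mem_antidiagonal] at hij
      rw [← hij.2.2, zpow_add₀ hq]
      ring

/-- The automorphism `τ : g(s) ↦ g(sq)` of the loop group. -/
def tauGroup (q : ℂˣ) : LSL2 →* LSL2 := Matrix.SpecialLinearGroup.map (qShift q)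

/-- The automorphism `τ : ξ(s) ↦ ξ(sq)` of the loop algebra. -/
def tauLie (q : ℂˣ) : Lsl2 →ₗ[ℂ] Lsl2 where
  toFun ξ := ⟨ξ.1.map (qShift q), by
    have h := congrArg (qShift q) (trace_eq_zero_of_mem ξ)
    simpa [Matrix.trace_fin_two] using h⟩
  map_add' ξ ζ := by
    apply Subtype.ext
    ext1 i j
    simp
  map_smul' c ξ := by
    apply Subtype.ext
    ext i j n
    simp [qShift, mul_left_comm]

/-- The `q`-gauge action `g(s) · M(s) = g(sq) M(s) g(s)⁻¹`. -/
def qGauge (q : ℂˣ) (g M : LSL2) : LSL2 := tauGroup q g * M * g⁻¹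

/-- The unipotent subgroup `LN` of matrices `(1, x(s); 0, 1)`. -/
def LN : Subgroup LSL2 where
  carrier := {g | g.1 0 0 = 1 ∧ g.1 1 0 = 0 ∧ g.1 1 1 = 1}
  one_mem' := by simp
  mul_mem' := by
    rintro g h ⟨g1, g2, g3⟩ ⟨h1, h2, h3⟩
    simp [Matrix.mul_apply, Fin.sum_univ_two, g1, g2, g3, h1, h2, h3]
  inv_mem' := by
    rintro g ⟨g1, g2, g3⟩
    simp [Matrix.SpecialLinearGroup.coe_inv, Matrix.adjugate_fin_two, g1, g2, g3]

/-! ### Gradients -/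

/-- A curve in the loop group that is polynomial in the parameter `t`, i.e. an element of
`SL₂(ℂ((s))[t])`. -/
abbrev PolyCurve : Type := Matrix.SpecialLinearGroup (Fin 2) (Polynomial Loop)

/-- The point of a polynomial curve at time `t`. -/
def PolyCurve.eval (γ : PolyCurve) (t : ℂ) : LSL2 :=
  Matrix.SpecialLinearGroup.map (Polynomial.evalRingHom (HahnSeries.C t : Loop)) γ

/-- `γ(t) = 1 + t ξ + O(t²)`. Such curves replace `e^{tξ}`, which has in general no meaning in
`SL₂(ℂ((s)))` (for instance for `ξ = H s⁻¹`). -/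
def PolyCurve.IsTangent (γ : PolyCurve) (ξ : Lsl2) : Prop :=
  ∀ i j, (γ.1 i j).coeff 0 = (1 : Matrix (Fin 2) (Fin 2) Loop) i j ∧ (γ.1 i j).coeff 1 = ξ.1 i j

/-- The `s`-adic continuity of a linear functional on `Lsl₂`: it vanishes on `s^N sl₂[[s]]` for
some `N`. -/
def SAdicContinuous (A : Lsl2 →ₗ[ℂ] ℂ) : Prop :=
  ∃ N : ℤ, ∀ ξ : Lsl2, (∀ i j, ∀ n < N, (ξ.1 i j).coeff n = 0) → A ξ = 0

/-- `A` is the left gradient of the functional `f` at `x`: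
`A(ξ) = d/dt f(e^{tξ} x)` at `t = 0`. -/
def IsLeftGradient (f : LSL2 → ℂ) (x : LSL2) (A : Lsl2 →ₗ[ℂ] ℂ) : Prop :=
  SAdicContinuous A ∧ ∀ (ξ : Lsl2) (γ : PolyCurve), γ.IsTangent ξ →
    HasDerivAt (fun t : ℂ => f (γ.eval t * x)) (A ξ) 0

/-- `A` is the right gradient of the functional `f` at `x`:
`A(ξ) = d/dt f(x e^{tξ})` at `t = 0`. -/
def IsRightGradient (f : LSL2 → ℂ) (x : LSL2) (A : Lsl2 →ₗ[ℂ] ℂ) : Prop :=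
  SAdicContinuous A ∧ ∀ (ξ : Lsl2) (γ : PolyCurve), γ.IsTangent ξ →
    HasDerivAt (fun t : ℂ => f (x * γ.eval t)) (A ξ) 0

/-- Functionals that have gradients at all points. -/
def IsDifferentiable (f : LSL2 → ℂ) : Prop :=
  ∀ x, (∃ A, IsLeftGradient f x A) ∧ ∃ A, IsRightGradient f x A

/-- Every element of `Lsl₂` is the velocity of a polynomial curve. -/
theorem exists_isTangent (ξ : Lsl2) : ∃ γ : PolyCurve, γ.IsTangent ξ := by
  let u : Loop → PolyCurve := fun a => ⟨!![1, Polynomial.X * Polynomial.C a; 0, 1], by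
    simp [Matrix.det_fin_two]⟩
  let l : Loop → PolyCurve := fun a => ⟨!![1, 0; Polynomial.X * Polynomial.C a, 1], by
    simp [Matrix.det_fin_two]⟩
  let w : Loop → PolyCurve := fun a =>
    ⟨!![1 + Polynomial.X * Polynomial.C a, -(Polynomial.X * Polynomial.C a);
      Polynomial.X * Polynomial.C a, 1 - Polynomial.X * Polynomial.C a], by
    rw [Matrix.det_fin_two]; simp; ring⟩
  refine ⟨w (ξ.1 0 0) * (u (ξ.1 0 1 + ξ.1 0 0) * l (ξ.1 1 0 - ξ.1 0 0)), ?_⟩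
  have h : ξ.1 1 1 = -ξ.1 0 0 := by
    rw [eq_neg_iff_add_eq_zero, add_comm]; exact trace_eq_zero_of_mem ξ
  intro i j
  have hm : (w (ξ.1 0 0) * (u (ξ.1 0 1 + ξ.1 0 0) * l (ξ.1 1 0 - ξ.1 0 0))).1 =
    (w (ξ.1 0 0)).1 * ((u (ξ.1 0 1 + ξ.1 0 0)).1 * (l (ξ.1 1 0 - ξ.1 0 0)).1) := rfl
  rw [hm]
  constructor
  · fin_cases i <;> fin_cases j <;>
      simp [u, l, w, Matrix.mul_apply, Fin.sum_univ_two, Polynomial.mul_coeff_zero]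
  · fin_cases i <;> fin_cases j <;>
      simp [u, l, w, Matrix.mul_apply, Fin.sum_univ_two, Polynomial.mul_coeff_one, Polynomial.coeff_one, h]

theorem IsLeftGradient.unique {f : LSL2 → ℂ} {x : LSL2} {A B : Lsl2 →ₗ[ℂ] ℂ}
    (hA : IsLeftGradient f x A) (hB : IsLeftGradient f x B) : A = B := by
  ext1 ξ
  obtain ⟨γ, hγ⟩ := exists_isTangent ξ
  exact (hA.2 ξ γ hγ).unique (hB.2 ξ γ hγ)

theorem IsRightGradient.unique {f : LSL2 → ℂ} {x : LSL2} {A B : Lsl2 →ₗ[ℂ] ℂ}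
    (hA : IsRightGradient f x A) (hB : IsRightGradient f x B) : A = B := by
  ext1 ξ
  obtain ⟨γ, hγ⟩ := exists_isTangent ξ
  exact (hA.2 ξ γ hγ).unique (hB.2 ξ γ hγ)

open Classical in
/-- The left gradient `∇f(x)` (zero if it does not exist). -/
def leftGrad (f : LSL2 → ℂ) (x : LSL2) : Lsl2 →ₗ[ℂ] ℂ :=
  if h : ∃ A, IsLeftGradient f x A then h.choose else 0

open Classical in
/-- The right gradient `∇'f(x)` (zero if it does not exist). -/
def rightGrad (f : LSL2 → ℂ) (x : LSL2) : Lsl2 →ₗ[ℂ] ℂ :=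
  if h : ∃ A, IsRightGradient f x A then h.choose else 0

/-! ### The `r`-matrix and the Poisson brackets -/

/-- The pairing `⟨r, A ⊗ B⟩` with
`r = ∑ₙ E_n ⊗ F_{-n} + 1/2 ∑ₙ φ_n H_n ⊗ H_{-n}`.
Both sums are finite when `A` and `B` are `s`-adically continuous. -/
def rPair (φ : ℤ → ℂ) (A B : Lsl2 →ₗ[ℂ] ℂ) : ℂ :=
  (∑ᶠ n : ℤ, A (slE n) * B (slF (-n))) +
    (1 / 2) * ∑ᶠ n : ℤ, φ n * (A (slH n) * B (slH (-n)))

/-- The pairing `⟨r, A ∧ B⟩`, where `A ∧ B = (A ⊗ B - B ⊗ A) / 2`. -/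
def rWedge (φ : ℤ → ℂ) (A B : Lsl2 →ₗ[ℂ] ℂ) : ℂ :=
  (rPair φ A B - rPair φ B A) / 2

/-- The pairing `⟨(id ⊗ τ)(r), A ⊗ B⟩`. -/
def rTwist (q : ℂˣ) (φ : ℤ → ℂ) (A B : Lsl2 →ₗ[ℂ] ℂ) : ℂ :=
  rPair φ A (B ∘ₗ tauLie q)

/-- The bracket `η`: `{f, h} = ⟨r, ∇f ∧ ∇h - ∇'f ∧ ∇'h⟩`. -/
def etaBracket (φ : ℤ → ℂ) (f h : LSL2 → ℂ) : LSL2 → ℂ := fun x =>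
  rWedge φ (leftGrad f x) (leftGrad h x) - rWedge φ (rightGrad f x) (rightGrad h x)

/-- The bracket `η_*^q`:
`{f, h} = ⟨r, ∇f ∧ ∇h + ∇'f ∧ ∇'h⟩ - ⟨(id ⊗ τ)(r), ∇'f ⊗ ∇h - ∇'h ⊗ ∇f⟩`. -/
def etaStarBracket (q : ℂˣ) (φ : ℤ → ℂ) (f h : LSL2 → ℂ) : LSL2 → ℂ := fun x =>
  rWedge φ (leftGrad f x) (leftGrad h x) + rWedge φ (rightGrad f x) (rightGrad h x)
    - (rTwist q φ (rightGrad f x) (leftGrad h x) - rTwist q φ (rightGrad h x) (leftGrad f x))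

/-! ### Functionals -/

/-- The functional `∑_{m₁ + ⋯ + m_k = M} c(m₁, …, m_k) x_{e₁, m₁} ⋯ x_{e_k, m_k}`, where `x_{e, m}`
is the `m`-th Fourier coefficient of the matrix entry of `x` at position `e`. Only finitely many
terms are non-zero at a given `x`. -/
def homFunctional {k : ℕ} (M : ℤ) (e : Fin k → Fin 2 × Fin 2) (c : (Fin k → ℤ) → ℂ) :
    LSL2 → ℂ := fun x =>
  ∑ᶠ m : {m : Fin k → ℤ // ∑ i, m i = M}, c m.1 * ∏ i, (x.1 (e i).1 (e i).2).coeff (m.1 i)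

/-- The algebra of functionals on `SL₂(ℂ((s)))`: the finite linear combinations of the functionals
`homFunctional M e c` (which are closed under products, so that these linear combinations are
the subalgebra they generate). -/
def functionals : Subalgebra ℂ (LSL2 → ℂ) :=
  Algebra.adjoin ℂ {f | ∃ (k : ℕ) (M : ℤ) (e : Fin k → Fin 2 × Fin 2) (c : (Fin k → ℤ) → ℂ),
    f = homFunctional M e c}

/-- The functionals that are invariant under the `q`-gauge action of the subgroup `K`. -/
def invariantFunctionals (q : ℂˣ) (K : Subgroup LSL2) : Subalgebra ℂ (LSL2 → ℂ) where
  carrier := {f | f ∈ functionals ∧ ∀ g ∈ K, ∀ x, f (qGauge q g x) = f x}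
  mul_mem' := by
    rintro f h ⟨hf, hf'⟩ ⟨hh, hh'⟩
    exact ⟨mul_mem hf hh, fun g hg x => by simp [hf' g hg x, hh' g hg x]⟩
  add_mem' := by
    rintro f h ⟨hf, hf'⟩ ⟨hh, hh'⟩
    exact ⟨add_mem hf hh, fun g hg x => by simp [hf' g hg x, hh' g hg x]⟩
  algebraMap_mem' c := ⟨functionals.algebraMap_mem c, fun _ _ _ => rfl⟩

/-! ### Poisson algebras and Poisson maps -/

/-- A bracket operation on functions. -/
abbrev Bracket : Type := (LSL2 → ℂ) → (LSL2 → ℂ) → LSL2 → ℂ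

/-- `br` restricts to a Poisson bracket on the algebra `S` of functions. -/
structure IsPoissonBracketOn (S : Subalgebra ℂ (LSL2 → ℂ)) (br : Bracket) : Prop where
  mem : ∀ f ∈ S, ∀ g ∈ S, br f g ∈ S
  add_left : ∀ f ∈ S, ∀ g ∈ S, ∀ h ∈ S, br (f + g) h = br f h + br g h
  smul_left : ∀ (c : ℂ), ∀ f ∈ S, ∀ g ∈ S, br (c • f) g = c • br f g
  skew : ∀ f ∈ S, ∀ g ∈ S, br f g = -br g f
  leibniz : ∀ f ∈ S, ∀ g ∈ S, ∀ h ∈ S, br f (g * h) = br f g * h + g * br f h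
  jacobi : ∀ f ∈ S, ∀ g ∈ S, ∀ h ∈ S,
    br f (br g h) + br g (br h f) + br h (br f g) = 0

/-- The bracket of two functions on a product `(LSL₂, br₁) × (LSL₂, br₂)`, where each factor is
differentiated separately. -/
def prodBracket (br₁ br₂ : Bracket) (Φ Ψ : LSL2 → LSL2 → ℂ) (g x : LSL2) : ℂ :=
  br₁ (fun g' => Φ g' x) (fun g' => Ψ g' x) g + br₂ (fun x' => Φ g x') (fun x' => Ψ g x') x

/-- `a : (LSL₂, br₁) × (LSL₂, br₂) → (LSL₂, br)` is a Poisson map: pull-backs of differentiable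
functionals are differentiable in each variable, and pull-back preserves brackets. -/
structure IsPoissonMap (br₁ br₂ br : Bracket) (a : LSL2 → LSL2 → LSL2) : Prop where
  differentiable_left : ∀ f, IsDifferentiable f → ∀ x, IsDifferentiable fun g => f (a g x)
  differentiable_right : ∀ f, IsDifferentiable f → ∀ g, IsDifferentiable fun x => f (a g x)
  bracket : ∀ f h, IsDifferentiable f → IsDifferentiable h → ∀ g x,
    prodBracket br₁ br₂ (fun g' x' => f (a g' x')) (fun g' x' => h (a g' x')) g x =
      br f h (a g x)

/-- The subgroup `K` is admissible for the `q`-gauge action on `(M_{2,q}, br)`: the `K`-invariant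
functionals form a Poisson subalgebra. -/
def IsAdmissible (q : ℂˣ) (br : Bracket) (K : Subgroup LSL2) : Prop :=
  ∀ f ∈ invariantFunctionals q K, ∀ h ∈ invariantFunctionals q K,
    br f h ∈ invariantFunctionals q K

end QLoop

end

/-!
The brackets are built from `r`-matrices, and everything reduces to linear algebra over `ℂ((s))`
once functionals on the loop group are brought under control.

*Linear algebra.* A continuous functional on the loop algebra is the residue pairing
`⟨a, ξ⟩ = Res tr(aξ) ds/s` with a traceless matrix `a` (`exists_dual`), and then
`⟨r, A ⊗ B⟩ = ⟨a, P b⟩`, where `P` keeps the upper triangular part, kills the lower triangular part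
and multiplies the Fourier coefficients of the diagonal part by `φ` (`rPair_eq`). The condition
`φ_n + φ_{-n} = 1` says `P + P* = 1` (`trc_rOp_add`), i.e. the symmetric part of `r` is half the
invariant form.

*Calculus.* On each lattice `s^N Mat₂(ℂ[[s]])` a functional in `R` is a polynomial in finitely many
Fourier coefficients (`IsRegular`, `exists_isRegular`). Hence it has first and second derivatives,
the second ones are symmetric, and they are continuous uniformly on lattices, so that the infinite
sums in `r` are locally finite and can be differentiated term by term. The brackets preserve `R`
because the translations by `E_n`, `H_n`, `F_n` shift Fourier modes by `n`: in the sum over `n` of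
products of homogeneous functionals with opposite shifts, the value of `n` is determined by the
degree of the first factor, so the sum is again homogeneous (`finsum_homSeries_mul`).

*Poisson maps.* All gradients of `f(gx)` and `f(τ(g)xg⁻¹)` are expressed through the left
gradient `L` of `f` at the image point, using `∇'f(x) = ∇f(x) ∘ Ad x`. For `q`-gauge
transformations the left gradient in `g` is `L ∘ τ - ∇'f`, and the claim follows from `τ`-invariance
of `r` and `Ad`-invariance of its symmetric part (`isPoissonMap_qGauge`).

*Jacobi identity.* Both brackets have the form `{f, h} = X_h f`, where `X_h` is the derivative along a
Hamiltonian vector `(u_h, v_h)` of left and right translations that depends linearly on the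
gradients of `h` (`genPair_eq`). By symmetry of the second derivatives the Jacobiator is the cyclic
sum of `⟨a_h, [u_g, u_f]⟩ - ⟨b_h, [v_g, v_f]⟩`, with `a_h` and `b_h` representing the gradients of `h`.
This sum is a polynomial identity in the matrix entries (`brTrc_rho`, `brTrc_star`, forms of the modified
classical Yang–Baxter equation), up to a multiple of
`⟨a_f, [a_g, a_h]⟩ - ⟨b_f, [b_g, b_h]⟩`, which vanishes because `b = Ad x⁻¹ a`.

*Admissibility.* For `LN`-invariant `f` and `h` the Poisson property of the action leaves only
the `η`-bracket of `g ↦ f(g · M)` and `g ↦ h(g · M)` at `g ∈ LN` to be shown to vanish. The gradients of these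
functions kill the upper triangular part, and on the diagonal part the left and right gradients
agree (`rPair_comp_adLie_of_mem`).
-/

noncomputable section

set_option linter.unusedSimpArgs false

namespace QLoop

/-! ### Lattices in the loop space -/

-- Restatements of general lemmas for the instances found on `Loop`, which `rw` and `simp` do not
-- match with those in the general statements.
theorem loop_neg_mul (a b : Loop) : -a * b = -(a * b) := neg_mul a b
theorem loop_mul_neg (a b : Loop) : a * -b = -(a * b) := mul_neg a b
theorem loop_smul_mul (t : ℂ) (a b : Loop) : t • a * b = t • (a * b) := by
  rw [← HahnSeries.C_mul_eq_smul, ← HahnSeries.C_mul_eq_smul, mul_assoc]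
theorem loop_mul_smul (t : ℂ) (a b : Loop) : a * t • b = t • (a * b) := by
  rw [← HahnSeries.C_mul_eq_smul, ← HahnSeries.C_mul_eq_smul, mul_left_comm]

/-- The space of all `2 × 2` matrices over `ℂ((s))`, in which the loop group sits. -/
abbrev LMat : Type := Matrix (Fin 2) (Fin 2) Loop

/-- The series `a` lies in `s^N ℂ[[s]]`. -/
def VanishBelow (N : ℤ) (a : Loop) : Prop := ∀ n < N, a.coeff n = 0

/-- The matrix `x` lies in the lattice `s^N Mat₂(ℂ[[s]])`. -/
def Lat (N : ℤ) (x : LMat) : Prop := ∀ i j, VanishBelow N (x i j)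

theorem VanishBelow.anti {N M : ℤ} (h : M ≤ N) {a : Loop} (ha : VanishBelow N a) :
    VanishBelow M a := fun n hn => ha n (hn.trans_le h)

theorem exists_vanishBelow (a : Loop) : ∃ N, VanishBelow N a :=
  ⟨a.order, fun _ hn => HahnSeries.coeff_eq_zero_of_lt_order hn⟩

theorem VanishBelow.zero (N : ℤ) : VanishBelow N 0 := fun _ _ => rfl

theorem VanishBelow.add {N : ℤ} {a b : Loop} (ha : VanishBelow N a) (hb : VanishBelow N b) :
    VanishBelow N (a + b) := fun n hn => by simp [ha n hn, hb n hn]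

theorem VanishBelow.neg {N : ℤ} {a : Loop} (ha : VanishBelow N a) :
    VanishBelow N (-a) := fun n hn => by rw [HahnSeries.coeff_neg, ha n hn, neg_zero]

theorem VanishBelow.smul {N : ℤ} {a : Loop} (c : ℂ) (ha : VanishBelow N a) :
    VanishBelow N (c • a) := fun n hn => by rw [HahnSeries.coeff_smul, ha n hn, smul_zero]

/-- The coefficients of a product as a sum over an interval that depends only on the lattices
containing the factors. -/
theorem coeff_mul_eq_sum_Icc {N M : ℤ} {a b : Loop} (ha : VanishBelow N a) (hb : VanishBelow M b)
    (n : ℤ) : (a * b).coeff n = ∑ k ∈ Finset.Icc N (n - M), a.coeff k * b.coeff (n - k) := by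
  rw [HahnSeries.coeff_mul]
  refine Finset.sum_bij_ne_zero (fun ij _ _ => ij.1) ?_ ?_ ?_ ?_
  · rintro ⟨i, j⟩ h1 h2
    simp only [Finset.mem_antidiagonal] at h1
    simp only [ne_eq, mul_eq_zero, not_or] at h2
    have hi : N ≤ i := not_lt.1 fun h => h2.1 (ha i h)
    have hj : M ≤ j := not_lt.1 fun h => h2.2 (hb j h)
    simp only [Finset.mem_Icc]
    have := h1.2.2
    omega
  · rintro ⟨i, j⟩ h1 _ ⟨i', j'⟩ h1' _ h
    simp only [Finset.mem_antidiagonal] at h1 h1'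
    have h3 := h1.2.2
    have h4 := h1'.2.2
    simp only at h h3 h4
    ext <;> simp <;> omega
  · intro k hk h
    simp only [ne_eq, mul_eq_zero, not_or] at h
    refine ⟨(k, n - k), ?_, ?_, rfl⟩
    · simp [h.1, h.2]
    · simpa using h
  · rintro ⟨i, j⟩ h1 h2
    simp only [Finset.mem_antidiagonal] at h1
    have h3 : j = n - i := by have := h1.2.2; omega
    simp [h3]

theorem VanishBelow.mul {N M : ℤ} {a b : Loop} (ha : VanishBelow N a) (hb : VanishBelow M b) :
    VanishBelow (N + M) (a * b) := fun n hn => by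
  rw [coeff_mul_eq_sum_Icc ha hb, Finset.Icc_eq_empty (by omega), Finset.sum_empty]

theorem VanishBelow.mono_self (n : ℤ) : VanishBelow n (mono n) := fun m hm => by
  simp [mono, HahnSeries.coeff_single_of_ne hm.ne]

theorem mono_coeff (n m : ℤ) : (mono n).coeff m = if m = n then 1 else 0 := by
  by_cases h : m = n <;> simp [mono, h]

theorem coeff_mul_mono (a : Loop) (n m : ℤ) : (a * mono n).coeff m = a.coeff (m - n) := by
  have := HahnSeries.coeff_mul_single_add (r := (1 : ℂ)) (x := a) (a := m - n) (b := n)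
  simpa [mono] using this

theorem coeff_mono_mul (a : Loop) (n m : ℤ) : (mono n * a).coeff m = a.coeff (m - n) := by
  rw [mul_comm, coeff_mul_mono]

theorem Lat.anti {N M : ℤ} (h : M ≤ N) {x : LMat} (hx : Lat N x) : Lat M x :=
  fun i j => (hx i j).anti h

theorem exists_lat (x : LMat) : ∃ N, Lat N x := by
  choose N hN using fun i j => exists_vanishBelow (x i j)
  refine ⟨min (min (N 0 0) (N 0 1)) (min (N 1 0) (N 1 1)), fun i j => (hN i j).anti ?_⟩
  fin_cases i <;> fin_cases j <;> simp

theorem Lat.add {N : ℤ} {x y : LMat} (hx : Lat N x) (hy : Lat N y) : Lat N (x + y) :=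
  fun i j => (hx i j).add (hy i j)

theorem Lat.smul {N : ℤ} {x : LMat} (c : ℂ) (hx : Lat N x) : Lat N (c • x) :=
  fun i j => (hx i j).smul c

theorem Lat.mul {N M : ℤ} {x y : LMat} (hx : Lat N x) (hy : Lat M y) : Lat (N + M) (x * y) := by
  intro i j
  rw [Matrix.mul_apply, Fin.sum_univ_two]
  exact ((hx i 0).mul (hy 0 j)).add ((hx i 1).mul (hy 1 j))

/-! ### Continuous functionals as Laurent series -/

/-- The coefficientwise multiplication of a Laurent series by a sequence. -/
def mulCoeff (φ : ℤ → ℂ) : Loop →ₗ[ℂ] Loop where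
  toFun a :=
    { coeff := fun n => φ n * a.coeff n
      isPWO_support' := a.isPWO_support.mono fun n hn => by
        simp only [Function.mem_support, ne_eq, mul_eq_zero, not_or] at hn
        exact hn.2 }
  map_add' a b := by ext n; simp [mul_add]
  map_smul' c a := by ext n; simp [mul_left_comm]

@[simp] theorem mulCoeff_coeff (φ : ℤ → ℂ) (a : Loop) (n : ℤ) :
    (mulCoeff φ a).coeff n = φ n * a.coeff n := rfl

theorem qShift_coeff (q : ℂˣ) (a : Loop) (n : ℤ) :
    (qShift q a).coeff n = (q : ℂ) ^ n * a.coeff n := rfl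

/-- The residue pairing of two Laurent series, as a sum over all Fourier modes. -/
theorem finsum_coeff_mul_coeff (a b : Loop) :
    ∑ᶠ n : ℤ, a.coeff (-n) * b.coeff n = (a * b).coeff 0 := by
  obtain ⟨N, hN⟩ := exists_vanishBelow a
  obtain ⟨M, hM⟩ := exists_vanishBelow b
  rw [mul_comm, coeff_mul_eq_sum_Icc hM hN,
    finsum_eq_sum_of_support_subset (s := Finset.Icc M (0 - N))]
  · exact Finset.sum_congr rfl fun n _ => by rw [zero_sub, mul_comm]
  · intro n hn
    simp only [Function.mem_support, ne_eq, mul_eq_zero, not_or] at hn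
    have h1 : N ≤ -n := not_lt.1 fun h => hn.1 (hN _ h)
    have h2 : M ≤ n := not_lt.1 fun h => hn.2 (hM _ h)
    simp only [Finset.coe_Icc, Set.mem_Icc]
    omega

/-- A linear functional on `ℂ((s))` that is continuous and vanishes on all monomials is zero. -/
theorem linearMap_eq_zero_of_mono (l : Loop →ₗ[ℂ] ℂ) (hl : ∃ N, ∀ a, VanishBelow N a → l a = 0)
    (h : ∀ n, l (mono n) = 0) : l = 0 := by
  obtain ⟨N, hN⟩ := hl
  ext1 a
  obtain ⟨M, hM⟩ := exists_vanishBelow a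
  have h1 : l (a - ∑ n ∈ Finset.Ico M N, a.coeff n • mono n) = 0 := by
    refine hN _ fun n hn => ?_
    simp only [HahnSeries.coeff_sub, HahnSeries.coeff_sum, HahnSeries.coeff_smul, mono_coeff,
      smul_eq_mul, mul_ite, mul_one, mul_zero, Finset.sum_ite_eq, Finset.mem_Ico]
    split_ifs with h
    · simp
    · rw [hM n (by omega), sub_zero]
  simpa [h] using h1

/-- A continuous functional on `ℂ((s))` is the residue pairing with the series whose `n`-th
coefficient is its value at `s ^ (-n)`. -/
theorem exists_series (l : Loop →ₗ[ℂ] ℂ) (hl : ∃ N, ∀ a, VanishBelow N a → l a = 0) :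
    ∃ d : Loop, ∀ a, l a = (d * a).coeff 0 := by
  obtain ⟨N, hN⟩ := hl
  have hb : ∀ n, n < -N → l (mono (-n)) = 0 := fun n hn =>
    hN _ ((VanishBelow.mono_self _).anti (by omega))
  have hbdd : BddBelow (Function.support fun n : ℤ => l (mono (-n))) :=
    ⟨-N, fun n hn => not_lt.1 fun h => hn (hb n h)⟩
  let d : Loop := HahnSeries.ofSuppBddBelow (fun n : ℤ => l (mono (-n))) hbdd
  have hd : ∀ n, d.coeff n = l (mono (-n)) := fun n => by simp [d]
  have hdv : VanishBelow (-N) d := fun n hn => by rw [hd, hb n hn]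
  let l' : Loop →ₗ[ℂ] ℂ :=
    { toFun := fun a => (d * a).coeff 0
      map_add' := fun a b => by simp [mul_add]
      map_smul' := fun c a => by simp [loop_mul_smul] }
  have : l - l' = 0 := by
    refine linearMap_eq_zero_of_mono _ ⟨N + 1, fun a ha => ?_⟩ fun n => ?_
    · have h2 : (d * a).coeff 0 = 0 := (hdv.mul ha) 0 (by omega)
      simp [l', hN a (ha.anti (by omega)), h2]
    · simp [l', coeff_mul_mono, hd]
  refine ⟨d, fun a => ?_⟩
  have := LinearMap.congr_fun this a
  simpa [l', sub_eq_zero] using this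

/-! ### The residue form and the dual matrix -/

/-- The residue of the trace form, `⟨a, b⟩ = Res tr(ab) ds/s`. -/
def trc (a b : LMat) : ℂ := (Matrix.trace (a * b)).coeff 0

theorem trc_add_right (a b c : LMat) : trc a (b + c) = trc a b + trc a c := by
  simp [trc, mul_add]

theorem trc_add_left (a b c : LMat) : trc (a + b) c = trc a c + trc b c := by
  simp [trc, add_mul]

theorem trc_eq (a b : LMat) : trc a b = (a 0 0 * b 0 0).coeff 0 + (a 0 1 * b 1 0).coeff 0 +
    ((a 1 0 * b 0 1).coeff 0 + (a 1 1 * b 1 1).coeff 0) := by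
  rw [trc, Matrix.trace_fin_two, Matrix.mul_apply, Matrix.mul_apply, Fin.sum_univ_two,
    Fin.sum_univ_two]
  rfl

theorem trc_smul_right (t : ℂ) (a b : LMat) : trc a (t • b) = t * trc a b := by
  simp [trc_eq, loop_mul_smul, loop_smul_mul, mul_add]

theorem trc_smul_left (t : ℂ) (a b : LMat) : trc (t • a) b = t * trc a b := by
  simp [trc_eq, loop_mul_smul, loop_smul_mul, mul_add]

/-- The matrix `slMk e h f` as a linear function of its entries. -/
def slMkₗ : Loop × Loop × Loop →ₗ[ℂ] Lsl2 where
  toFun p := slMk p.1 p.2.1 p.2.2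
  map_add' p p' := by
    apply Subtype.ext; ext i j
    fin_cases i <;> fin_cases j <;> simp [slMk]; ring
  map_smul' c p := by
    apply Subtype.ext; ext i j
    fin_cases i <;> fin_cases j <;> simp [slMk]

theorem slMk_entries (ξ : Lsl2) : slMk (ξ.1 0 1) (ξ.1 0 0) (ξ.1 1 0) = ξ := by
  have h : ξ.1 1 1 = -ξ.1 0 0 := by
    rw [eq_neg_iff_add_eq_zero, add_comm]; exact trace_eq_zero_of_mem ξ
  apply Subtype.ext
  ext1 i j
  fin_cases i <;> fin_cases j <;> simp [slMk, h]

theorem lat_slMk {N : ℤ} {e h f : Loop} (he : VanishBelow N e) (hh : VanishBelow N h)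
    (hf : VanishBelow N f) : Lat N (slMk e h f).1 := by
  intro i j
  fin_cases i <;> fin_cases j <;> simp [slMk, *, VanishBelow.neg]

/-- Every continuous functional on `Lsl₂` is the residue pairing with a traceless matrix. -/
theorem exists_dual {A : Lsl2 →ₗ[ℂ] ℂ} (hA : SAdicContinuous A) :
    ∃ a : Lsl2, ∀ ξ : Lsl2, A ξ = trc a.1 ξ.1 := by
  obtain ⟨N, hN⟩ := hA
  have hz := VanishBelow.zero N
  obtain ⟨e, he⟩ := exists_series (A ∘ₗ slMkₗ ∘ₗ LinearMap.inl ℂ Loop (Loop × Loop))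
    ⟨N, fun a ha => hN _ (lat_slMk ha hz hz)⟩
  obtain ⟨h, hh⟩ := exists_series
    (A ∘ₗ slMkₗ ∘ₗ LinearMap.inr ℂ Loop (Loop × Loop) ∘ₗ LinearMap.inl ℂ Loop Loop)
    ⟨N, fun a ha => hN _ (lat_slMk hz ha hz)⟩
  obtain ⟨f, hf⟩ := exists_series
    (A ∘ₗ slMkₗ ∘ₗ LinearMap.inr ℂ Loop (Loop × Loop) ∘ₗ LinearMap.inr ℂ Loop Loop)
    ⟨N, fun a ha => hN _ (lat_slMk hz hz ha)⟩
  refine ⟨slMk f ((1 / 2 : ℂ) • h) e, fun ξ => ?_⟩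
  have h1 : ξ = slMkₗ (ξ.1 0 1, 0, 0) + slMkₗ (0, ξ.1 0 0, 0) + slMkₗ (0, 0, ξ.1 1 0) := by
    rw [← map_add, ← map_add]
    simpa [slMkₗ] using (slMk_entries ξ).symm
  have e1 := he (ξ.1 0 1)
  have e2 := hh (ξ.1 0 0)
  have e3 := hf (ξ.1 1 0)
  simp only [LinearMap.comp_apply, LinearMap.inl_apply, LinearMap.inr_apply] at e1 e2 e3
  have h4 : ξ.1 1 1 = -ξ.1 0 0 := by
    rw [eq_neg_iff_add_eq_zero, add_comm]; exact trace_eq_zero_of_mem ξ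
  conv_lhs => rw [h1]
  rw [map_add, map_add]
  refine (congrArg₂ (· + ·) (congrArg₂ (· + ·) e1 e2) e3).trans ?_
  simp [trc_eq, loop_neg_mul, loop_mul_neg, loop_mul_smul, loop_smul_mul, slMk, h4]
  ring

/-! ### The `r`-matrix as an operator -/

/-- The operator of `r` for the residue form: `⟨r, A ⊗ B⟩ = ⟨a, P b⟩` if `a` and `b` represent
`A` and `B`. It kills the lower triangular part, keeps the upper triangular part, and multiplies
the Fourier coefficients of the diagonal part by `φ`. -/
def rOp (φ : ℤ → ℂ) (b : LMat) : LMat :=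
  !![mulCoeff φ (b 0 0), b 0 1; 0, -mulCoeff φ (b 0 0)]

/-- `⟨r, A ⊗ B⟩ = ⟨a, P b⟩`. -/
theorem rPair_eq (φ : ℤ → ℂ) {A B : Lsl2 →ₗ[ℂ] ℂ} {a b : Lsl2} (ha : ∀ ξ : Lsl2, A ξ = trc a.1 ξ.1)
    (hb : ∀ ξ : Lsl2, B ξ = trc b.1 ξ.1) : rPair φ A B = trc a.1 (rOp φ b.1) := by
  have a4 : a.1 1 1 = -a.1 0 0 := by
    rw [eq_neg_iff_add_eq_zero, add_comm]; exact trace_eq_zero_of_mem a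
  have b4 : b.1 1 1 = -b.1 0 0 := by
    rw [eq_neg_iff_add_eq_zero, add_comm]; exact trace_eq_zero_of_mem b
  have e1 : ∀ n, A (slE n) = (a.1 1 0).coeff (-n) := fun n => by
    simp [ha, trc_eq, loop_neg_mul, loop_mul_neg, loop_mul_smul, loop_smul_mul, slE, slMk,
      coeff_mul_mono]
  have e2 : ∀ n, B (slF (-n)) = (b.1 0 1).coeff n := fun n => by
    simp [hb, trc_eq, loop_neg_mul, loop_mul_neg, loop_mul_smul, loop_smul_mul, slF, slMk,
      coeff_mul_mono]
  have e3 : ∀ n, A (slH n) = 2 * (a.1 0 0).coeff (-n) := fun n => by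
    simp [ha, trc_eq, loop_neg_mul, loop_mul_neg, loop_mul_smul, loop_smul_mul, slH, slMk,
      coeff_mul_mono, a4]
    ring
  have e4 : ∀ n, B (slH (-n)) = 2 * (b.1 0 0).coeff n := fun n => by
    simp [hb, trc_eq, loop_neg_mul, loop_mul_neg, loop_mul_smul, loop_smul_mul, slH, slMk,
      coeff_mul_mono, b4]
    ring
  have s1 : ∑ᶠ n : ℤ, A (slE n) * B (slF (-n)) = (a.1 1 0 * b.1 0 1).coeff 0 := by
    rw [← finsum_coeff_mul_coeff]
    exact finsum_congr fun n => by rw [e1, e2]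
  have s2 : ∑ᶠ n : ℤ, φ n * (A (slH n) * B (slH (-n))) =
      ((((4 : ℂ) • a.1 0 0 : Loop)) * mulCoeff φ (b.1 0 0)).coeff 0 := by
    rw [← finsum_coeff_mul_coeff]
    exact finsum_congr fun n => by rw [e3, e4]; simp only [HahnSeries.coeff_smul, smul_eq_mul, mulCoeff_coeff]; ring
  rw [rPair, s1, s2]
  simp [trc_eq, loop_neg_mul, loop_mul_neg, loop_mul_smul, loop_smul_mul, rOp, a4]
  ring

/-- The condition `φ_n + φ_{-n} = 1` says that `P + P* = 1` on traceless matrices, i.e. that the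
symmetric part of `r` is half the Casimir tensor. -/
theorem trc_rOp_add {φ : ℤ → ℂ} (hφ : ∀ n, φ n + φ (-n) = 1) (a b : Lsl2) :
    trc a.1 (rOp φ b.1) + trc b.1 (rOp φ a.1) = trc a.1 b.1 := by
  have a4 : a.1 1 1 = -a.1 0 0 := by
    rw [eq_neg_iff_add_eq_zero, add_comm]; exact trace_eq_zero_of_mem a
  have b4 : b.1 1 1 = -b.1 0 0 := by
    rw [eq_neg_iff_add_eq_zero, add_comm]; exact trace_eq_zero_of_mem b
  have key : (a.1 0 0 * mulCoeff φ (b.1 0 0)).coeff 0 + (b.1 0 0 * mulCoeff φ (a.1 0 0)).coeff 0 =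
      (a.1 0 0 * b.1 0 0).coeff 0 := by
    have h1 : (b.1 0 0 * mulCoeff φ (a.1 0 0)).coeff 0 =
        (a.1 0 0 * mulCoeff (fun n => φ (-n)) (b.1 0 0)).coeff 0 := by
      rw [mul_comm, ← finsum_coeff_mul_coeff, ← finsum_coeff_mul_coeff]
      exact finsum_congr fun n => by simp; ring
    rw [h1, ← HahnSeries.coeff_add, ← mul_add]
    congr 2
    ext n
    simp only [HahnSeries.coeff_add, mulCoeff_coeff]
    rw [← add_mul, hφ, one_mul]
  simp [trc_eq, loop_neg_mul, loop_mul_neg, loop_mul_smul, loop_smul_mul, rOp, a4, b4]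
  rw [mul_comm (b.1 1 0) (a.1 0 1)]
  linear_combination 2 * key

/-! ### Calculus of polynomials in infinitely many variables -/

section Calculus
open MvPolynomial

section Polynomial
variable {I : Type*}

/-- The derivative of a polynomial in the constant direction `y`. -/
def polyDeriv (y : I → ℂ) : Derivation ℂ (MvPolynomial I ℂ) (MvPolynomial I ℂ) :=
  mkDerivation ℂ fun i => C (y i)

@[simp] theorem polyDeriv_X (y : I → ℂ) (i : I) : polyDeriv y (X i) = C (y i) :=
  mkDerivation_X _ _ _

theorem polyDeriv_add (y z : I → ℂ) (p : MvPolynomial I ℂ) :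
    polyDeriv (y + z) p = polyDeriv y p + polyDeriv z p := by
  have : polyDeriv (y + z) = polyDeriv y + polyDeriv z := derivation_ext fun i => by simp
  rw [this]; rfl

theorem polyDeriv_smul (c : ℂ) (y : I → ℂ) (p : MvPolynomial I ℂ) :
    polyDeriv (c • y) p = c • polyDeriv y p := by
  have : polyDeriv (c • y) = c • polyDeriv y := derivation_ext fun i => by simp [smul_eq_C_mul]
  rw [this]; rfl

theorem polyDeriv_eq_zero {y : I → ℂ} {p : MvPolynomial I ℂ} (h : ∀ i ∈ p.vars, y i = 0) :
    polyDeriv y p = 0 :=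
  derivation_eq_zero_of_forall_mem_vars fun i hi => by simp [h i hi]

theorem polyDeriv_comm (y z : I → ℂ) (p : MvPolynomial I ℂ) :
    polyDeriv y (polyDeriv z p) = polyDeriv z (polyDeriv y p) := by
  have h : ⁅polyDeriv y, polyDeriv z⁆ = 0 := derivation_ext fun i => by
    simp [Derivation.commutator_apply]
  have := congrArg (fun D => D p) h
  simpa [Derivation.commutator_apply, sub_eq_zero] using this

theorem hasDerivAt_eval {c : ℂ → I → ℂ} {c' : I → ℂ} {t : ℂ}
    (hc : ∀ i, HasDerivAt (fun t => c t i) (c' i) t) (p : MvPolynomial I ℂ) :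
    HasDerivAt (fun t => eval (c t) p) (eval (c t) (polyDeriv c' p)) t := by
  induction p using MvPolynomial.induction_on with
  | C a =>
    refine ((hasDerivAt_const t a).congr_deriv ?_).congr_of_eventuallyEq (.of_forall fun t => ?_)
    · simp
    · simp
  | add p q hp hq =>
    refine ((hp.add hq).congr_deriv ?_).congr_of_eventuallyEq (.of_forall fun t => ?_)
    · simp
    · simp
  | mul_X p i hp =>
    refine ((hp.mul (hc i)).congr_deriv ?_).congr_of_eventuallyEq (.of_forall fun t => ?_)
    · simp only [Derivation.leibniz, polyDeriv_X, smul_eq_mul, map_add, map_mul, eval_X, eval_C]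
      ring
    · simp

/-- The chain rule for the derivative in a varying direction. -/
theorem hasDerivAt_eval_polyDeriv {c w : ℂ → I → ℂ} {c' w' : I → ℂ} {t : ℂ}
    (hc : ∀ i, HasDerivAt (fun t => c t i) (c' i) t)
    (hw : ∀ i, HasDerivAt (fun t => w t i) (w' i) t) (p : MvPolynomial I ℂ) :
    HasDerivAt (fun t => eval (c t) (polyDeriv (w t) p))
      (eval (c t) (polyDeriv c' (polyDeriv (w t) p)) + eval (c t) (polyDeriv w' p)) t := by
  induction p using MvPolynomial.induction_on with
  | C a =>
    refine ((hasDerivAt_const t (0 : ℂ)).congr_deriv ?_).congr_of_eventuallyEq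
      (.of_forall fun t => ?_)
    · simp
    · simp
  | add p q hp hq =>
    refine ((hp.add hq).congr_deriv ?_).congr_of_eventuallyEq (.of_forall fun t => ?_)
    · simp only [map_add]; ring
    · simp
  | mul_X p i hp =>
    refine ((((hasDerivAt_eval hc p).mul (hw i)).add (hp.mul (hc i))).congr_deriv
      ?_).congr_of_eventuallyEq (.of_forall fun t => ?_)
    · simp only [Derivation.leibniz, polyDeriv_X, smul_eq_mul, map_add, map_mul, eval_X, eval_C,
        derivation_C, map_zero]
      ring
    · simp; ring

end Polynomial

/-! ### Curves and regular functions -/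

/-- The coordinates of a matrix over `ℂ((s))` are the Fourier coefficients of its entries. -/
abbrev Coord : Type := Fin 2 × Fin 2 × ℤ

/-- The coordinates of `x`. -/
def coords (x : LMat) (i : Coord) : ℂ := (x i.1 i.2.1).coeff i.2.2

theorem coords_add (x y : LMat) : coords (x + y) = coords x + coords y := by
  ext i; simp [coords]

theorem coords_smul (c : ℂ) (x : LMat) : coords (c • x) = c • coords x := by
  ext i; simp [coords]

theorem add_zero_smul_lmat (x y : LMat) : x + (0 : ℂ) • y = x := by
  ext i; simp

/-- The curve `c` stays in a lattice, and its Fourier coefficients have derivatives at `0`, which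
are the Fourier coefficients of `c'`. -/
def HasCoeffDeriv (c : ℂ → LMat) (c' : LMat) : Prop :=
  (∃ N, (∀ t, Lat N (c t)) ∧ Lat N c') ∧
    ∀ i, HasDerivAt (fun t => coords (c t) i) (coords c' i) 0

theorem HasCoeffDeriv.line (x y : LMat) : HasCoeffDeriv (fun t => x + t • y) y := by
  obtain ⟨N, hN⟩ := exists_lat x
  obtain ⟨M, hM⟩ := exists_lat y
  refine ⟨⟨min N M, fun t => (hN.anti (min_le_left _ _)).add ((hM.anti (min_le_right _ _)).smul t),
    hM.anti (min_le_right _ _)⟩, fun i => ?_⟩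
  simp only [coords_add, coords_smul, Pi.add_apply, Pi.smul_apply, smul_eq_mul]
  simpa using ((hasDerivAt_id (0 : ℂ)).mul_const (coords y i)).const_add (coords x i)

theorem HasCoeffDeriv.mul_left {c : ℂ → LMat} {c' : LMat} (h : HasCoeffDeriv c c') (u : LMat) :
    HasCoeffDeriv (fun t => u * c t) (u * c') := by
  obtain ⟨⟨N, hN, hN'⟩, hd⟩ := h
  obtain ⟨M, hM⟩ := exists_lat u
  refine ⟨⟨M + N, fun t => hM.mul (hN t), hM.mul hN'⟩, ?_⟩
  rintro ⟨i, j, n⟩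
  have e : ∀ y : LMat, Lat N y → coords (u * y) (i, j, n) =
      ∑ l, ∑ k ∈ Finset.Icc M (n - N), (u i l).coeff k * coords y (l, j, n - k) := fun y hy => by
    simp only [coords, Matrix.mul_apply, HahnSeries.coeff_sum]
    exact Finset.sum_congr rfl fun l _ => coeff_mul_eq_sum_Icc (hM i l) (hy l j) n
  simp only [e _ (hN _), e _ hN']
  exact HasDerivAt.fun_sum fun l _ => HasDerivAt.fun_sum fun k _ => (hd (l, j, n - k)).const_mul _

theorem HasCoeffDeriv.mul_right {c : ℂ → LMat} {c' : LMat} (h : HasCoeffDeriv c c') (u : LMat) :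
    HasCoeffDeriv (fun t => c t * u) (c' * u) := by
  obtain ⟨⟨N, hN, hN'⟩, hd⟩ := h
  obtain ⟨M, hM⟩ := exists_lat u
  refine ⟨⟨N + M, fun t => (hN t).mul hM, hN'.mul hM⟩, ?_⟩
  rintro ⟨i, j, n⟩
  have e : ∀ y : LMat, Lat N y → coords (y * u) (i, j, n) =
      ∑ l, ∑ k ∈ Finset.Icc M (n - N), (u l j).coeff k * coords y (i, l, n - k) := fun y hy => by
    simp only [coords, Matrix.mul_apply, HahnSeries.coeff_sum]
    refine Finset.sum_congr rfl fun l _ => ?_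
    rw [mul_comm]
    exact coeff_mul_eq_sum_Icc (hM l j) (hy i l) n
  simp only [e _ (hN _), e _ hN']
  exact HasDerivAt.fun_sum fun l _ => HasDerivAt.fun_sum fun k _ => (hd (i, l, n - k)).const_mul _

/-- A polynomial curve in the loop group tangent to `ξ` has derivative `ξ`. -/
theorem PolyCurve.IsTangent.hasCoeffDeriv {γ : PolyCurve} {ξ : Lsl2} (h : γ.IsTangent ξ) :
    HasCoeffDeriv (fun t => (γ.eval t).1) ξ.1 := by
  have he : ∀ t i j n, ((γ.eval t).1 i j).coeff n =
      ∑ k ∈ Finset.range ((γ.1 i j).natDegree + 1), t ^ k * ((γ.1 i j).coeff k).coeff n := by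
    intro t i j n
    have : (γ.eval t).1 i j = ∑ k ∈ Finset.range ((γ.1 i j).natDegree + 1),
        (t ^ k) • ((γ.1 i j).coeff k) := by
      have h1 : (γ.eval t).1 i j = (γ.1 i j).eval (HahnSeries.C t : Loop) := rfl
      rw [h1, Polynomial.eval_eq_sum_range]
      refine Finset.sum_congr rfl fun k _ => ?_
      rw [← map_pow, mul_comm, HahnSeries.C_mul_eq_smul]
    rw [this, HahnSeries.coeff_sum]
    simp
  have hb : ∃ N, ∀ i j k, VanishBelow N ((γ.1 i j).coeff k) := by
    have h1 : ∀ p : Polynomial Loop, ∃ N, ∀ k, VanishBelow N (p.coeff k) := fun p => by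
      choose f hf using fun k => exists_vanishBelow (p.coeff k)
      obtain ⟨N, hN⟩ := (p.support.image f).bddBelow
      refine ⟨N, fun k => ?_⟩
      by_cases hk : k ∈ p.support
      · exact (hf k).anti (hN (Finset.mem_coe.2 (Finset.mem_image_of_mem f hk)))
      · rw [Polynomial.notMem_support_iff.1 hk]
        exact VanishBelow.zero N
    choose N hN using fun i j => h1 (γ.1 i j)
    refine ⟨min (min (N 0 0) (N 0 1)) (min (N 1 0) (N 1 1)), fun i j k => (hN i j k).anti ?_⟩
    fin_cases i <;> fin_cases j <;> simp
  obtain ⟨N, hN⟩ := hb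
  refine ⟨⟨N, fun t i j n hn => ?_, fun i j => (h i j).2 ▸ hN i j 1⟩, ?_⟩
  · rw [he]
    exact Finset.sum_eq_zero fun k _ => by rw [hN i j k n hn, mul_zero]
  · rintro ⟨i, j, n⟩
    simp only [coords, he]
    rw [← (h i j).2]
    have hk : ∀ k : ℕ, HasDerivAt (fun t : ℂ => t ^ k * ((γ.1 i j).coeff k).coeff n)
        (if k = 1 then ((γ.1 i j).coeff 1).coeff n else 0) 0 := fun k => by
      refine ((hasDerivAt_pow k (0 : ℂ)).mul_const (((γ.1 i j).coeff k).coeff n)).congr_deriv ?_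
      rcases k with _ | _ | k <;> simp
    refine (HasDerivAt.fun_sum fun k _ => hk k).congr_deriv ?_
    rw [Finset.sum_ite_eq']
    split_ifs with h2
    · rfl
    · rw [Polynomial.coeff_eq_zero_of_natDegree_lt (by simpa using h2)]; rfl

/-- A function on the loop matrices is regular if it is on every lattice a polynomial in finitely
many Fourier coefficients. -/
def IsRegular (F : LMat → ℂ) : Prop :=
  ∀ N, ∃ p : MvPolynomial Coord ℂ, ∀ x, Lat N x → F x = eval (coords x) p

theorem IsRegular.const (a : ℂ) : IsRegular fun _ => a := fun _ => ⟨C a, by simp⟩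

theorem IsRegular.add {F G : LMat → ℂ} (hF : IsRegular F) (hG : IsRegular G) :
    IsRegular (F + G) := fun N => by
  obtain ⟨p, hp⟩ := hF N
  obtain ⟨r, hr⟩ := hG N
  exact ⟨p + r, fun x hx => by simp [hp x hx, hr x hx]⟩

theorem IsRegular.mul {F G : LMat → ℂ} (hF : IsRegular F) (hG : IsRegular G) :
    IsRegular (F * G) := fun N => by
  obtain ⟨p, hp⟩ := hF N
  obtain ⟨r, hr⟩ := hG N
  exact ⟨p * r, fun x hx => by simp [hp x hx, hr x hx]⟩

/-- The derivative of a function at `x` in the direction `y`. -/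
def dirDeriv (F : LMat → ℂ) (x y : LMat) : ℂ := deriv (fun t : ℂ => F (x + t • y)) 0

/-- The second derivative of a function at `x`, in the direction `z` and then in the direction
`y`. -/
def dirDeriv₂ (F : LMat → ℂ) (x y z : LMat) : ℂ :=
  deriv (fun t : ℂ => dirDeriv F (x + t • y) z) 0

section Lattice
variable {F : LMat → ℂ} {N : ℤ} {p : MvPolynomial Coord ℂ}

theorem hasDerivAt_of_poly (hp : ∀ x, Lat N x → F x = eval (coords x) p) {c : ℂ → LMat}
    {c' : LMat} (hc : ∀ t, Lat N (c t))
    (hd : ∀ i, HasDerivAt (fun t => coords (c t) i) (coords c' i) 0) :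
    HasDerivAt (fun t => F (c t)) (eval (coords (c 0)) (polyDeriv (coords c') p)) 0 := by
  simp only [hp _ (hc _)]
  exact hasDerivAt_eval hd p

theorem dirDeriv_eq (hp : ∀ x, Lat N x → F x = eval (coords x) p) {x y : LMat} (hx : Lat N x)
    (hy : Lat N y) : dirDeriv F x y = eval (coords x) (polyDeriv (coords y) p) := by
  have := (hasDerivAt_of_poly hp (c := fun t => x + t • y) (c' := y)
    (fun t => hx.add (hy.smul t)) (HasCoeffDeriv.line x y).2).deriv
  rwa [add_zero_smul_lmat] at this

theorem dirDeriv₂_eq (hp : ∀ x, Lat N x → F x = eval (coords x) p) {x y z : LMat} (hx : Lat N x)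
    (hy : Lat N y) (hz : Lat N z) : dirDeriv₂ F x y z =
      eval (coords x) (polyDeriv (coords y) (polyDeriv (coords z) p)) := by
  have := hasDerivAt_eval (c := fun t : ℂ => coords (x + t • y)) (HasCoeffDeriv.line x y).2
    (polyDeriv (coords z) p)
  simp only [dirDeriv₂, dirDeriv_eq hp (hx.add (hy.smul _)) hz]
  rw [this.deriv, add_zero_smul_lmat]

end Lattice

theorem exists_lat₂ (x y : LMat) : ∃ N, Lat N x ∧ Lat N y := by
  obtain ⟨N, hN⟩ := exists_lat x
  obtain ⟨M, hM⟩ := exists_lat y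
  exact ⟨min N M, hN.anti (min_le_left _ _), hM.anti (min_le_right _ _)⟩

theorem exists_lat₃ (x y z : LMat) : ∃ N, Lat N x ∧ Lat N y ∧ Lat N z := by
  obtain ⟨N, hN, hN'⟩ := exists_lat₂ x y
  obtain ⟨M, hM⟩ := exists_lat z
  exact ⟨min N M, hN.anti (min_le_left _ _), hN'.anti (min_le_left _ _),
    hM.anti (min_le_right _ _)⟩

namespace IsRegular
variable {F G : LMat → ℂ}

theorem hasDerivAt_comp (hF : IsRegular F) {c : ℂ → LMat} {c' : LMat} (hc : HasCoeffDeriv c c') :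
    HasDerivAt (fun t => F (c t)) (dirDeriv F (c 0) c') 0 := by
  obtain ⟨⟨N, hN, hN'⟩, hd⟩ := hc
  obtain ⟨p, hp⟩ := hF N
  rw [dirDeriv_eq hp (hN 0) hN']
  exact hasDerivAt_of_poly hp hN hd

theorem hasDerivAt_dirDeriv (hF : IsRegular F) {c w : ℂ → LMat} {c' w' : LMat}
    (hc : HasCoeffDeriv c c') (hw : HasCoeffDeriv w w') :
    HasDerivAt (fun t => dirDeriv F (c t) (w t))
      (dirDeriv₂ F (c 0) c' (w 0) + dirDeriv F (c 0) w') 0 := by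
  obtain ⟨⟨N, hN, hN'⟩, hd⟩ := hc
  obtain ⟨⟨M, hM, hM'⟩, hd'⟩ := hw
  obtain ⟨p, hp⟩ := hF (min N M)
  have h1 : ∀ {x : LMat}, Lat N x → Lat (min N M) x := fun h => h.anti (min_le_left _ _)
  have h2 : ∀ {x : LMat}, Lat M x → Lat (min N M) x := fun h => h.anti (min_le_right _ _)
  rw [dirDeriv_eq hp (h1 (hN 0)) (h2 hM'), dirDeriv₂_eq hp (h1 (hN 0)) (h1 hN') (h2 (hM 0))]
  simp only [dirDeriv_eq hp (h1 (hN _)) (h2 (hM _))]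
  exact hasDerivAt_eval_polyDeriv hd hd' p

theorem dirDeriv_add (hF : IsRegular F) (x y z : LMat) :
    dirDeriv F x (y + z) = dirDeriv F x y + dirDeriv F x z := by
  obtain ⟨N, hx, hy, hz⟩ := exists_lat₃ x y z
  obtain ⟨p, hp⟩ := hF N
  rw [dirDeriv_eq hp hx (hy.add hz), dirDeriv_eq hp hx hy, dirDeriv_eq hp hx hz, coords_add,
    polyDeriv_add, map_add]

theorem dirDeriv_smul (hF : IsRegular F) (c : ℂ) (x y : LMat) :
    dirDeriv F x (c • y) = c * dirDeriv F x y := by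
  obtain ⟨N, hx, hy⟩ := exists_lat₂ x y
  obtain ⟨p, hp⟩ := hF N
  rw [dirDeriv_eq hp hx (hy.smul c), dirDeriv_eq hp hx hy, coords_smul, polyDeriv_smul, smul_eval]

theorem dirDeriv₂_comm (hF : IsRegular F) (x y z : LMat) :
    dirDeriv₂ F x y z = dirDeriv₂ F x z y := by
  obtain ⟨N, hx, hy, hz⟩ := exists_lat₃ x y z
  obtain ⟨p, hp⟩ := hF N
  rw [dirDeriv₂_eq hp hx hy hz, dirDeriv₂_eq hp hx hz hy, polyDeriv_comm]

theorem dirDeriv₂_add (hF : IsRegular F) (x y z w : LMat) :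
    dirDeriv₂ F x y (z + w) = dirDeriv₂ F x y z + dirDeriv₂ F x y w := by
  obtain ⟨N, hx, hy, hz⟩ := exists_lat₃ x y z
  obtain ⟨M, hw⟩ := exists_lat w
  replace hx := hx.anti (min_le_left N M)
  replace hy := hy.anti (min_le_left N M)
  replace hz := hz.anti (min_le_left N M)
  replace hw := hw.anti (min_le_right N M)
  obtain ⟨p, hp⟩ := hF (min N M)
  rw [dirDeriv₂_eq hp hx hy (hz.add hw), dirDeriv₂_eq hp hx hy hz, dirDeriv₂_eq hp hx hy hw,
    coords_add, polyDeriv_add, map_add, map_add]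

theorem dirDeriv₂_smul (hF : IsRegular F) (c : ℂ) (x y z : LMat) :
    dirDeriv₂ F x y (c • z) = c * dirDeriv₂ F x y z := by
  obtain ⟨N, hx, hy, hz⟩ := exists_lat₃ x y z
  obtain ⟨p, hp⟩ := hF N
  rw [dirDeriv₂_eq hp hx hy (hz.smul c), dirDeriv₂_eq hp hx hy hz, coords_smul, polyDeriv_smul,
    Derivation.map_smul, smul_eval]

/-- The derivative of a regular function is continuous in the direction, uniformly on every
lattice of base points. -/
theorem exists_continuous (hF : IsRegular F) (N : ℤ) :
    ∃ K, ∀ x y, Lat N x → Lat K y → dirDeriv F x y = 0 := by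
  obtain ⟨p, hp⟩ := hF N
  -- Beyond the largest mode occurring in `p`, the derivative of `p` vanishes.
  obtain ⟨K, hK⟩ := (p.vars.image fun i : Coord => i.2.2).bddAbove
  refine ⟨max N (K + 1), fun x y hx hy => ?_⟩
  rw [dirDeriv_eq hp hx (hy.anti (le_max_left _ _)), polyDeriv_eq_zero, map_zero]
  intro i hi
  refine hy _ _ _ ?_
  have := hK (Finset.mem_image_of_mem _ hi)
  have := le_max_right N (K + 1)
  omega

end IsRegular

end Calculus

/-! ### Homogeneous functionals -/

section Hom
variable {ι ι' : Type} [Fintype ι] [Fintype ι']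

/-- The formula defining `homFunctional`, for an arbitrary finite index type and on all matrices. -/
def homSeries (M : ℤ) (e : ι → Fin 2 × Fin 2) (c : (ι → ℤ) → ℂ) (x : LMat) : ℂ :=
  ∑ᶠ m : ι → ℤ, if ∑ i, m i = M then c m * ∏ i, coords x ((e i).1, (e i).2, m i) else 0

theorem homSeries_eq_homFunctional {k : ℕ} (M : ℤ) (e : Fin k → Fin 2 × Fin 2)
    (c : (Fin k → ℤ) → ℂ) (x : LSL2) : homSeries M e c x.1 = homFunctional M e c x := by
  have := finsum_subtype_eq_finsum_cond
    (f := fun m : Fin k → ℤ => c m * ∏ i, (x.1 (e i).1 (e i).2).coeff (m i))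
    (p := fun m => ∑ i, m i = M)
  rw [homSeries, homFunctional, this]
  refine finsum_congr fun m => ?_
  rw [finsum_eq_if]
  rfl

theorem homSeries_reindex (f : ι' ≃ ι) (M : ℤ) (e : ι → Fin 2 × Fin 2) (c : (ι → ℤ) → ℂ)
    (x : LMat) : homSeries M e c x = homSeries M (e ∘ f) (fun m => c (m ∘ f.symm)) x := by
  rw [homSeries, homSeries, ← finsum_comp_equiv (f.arrowCongr (Equiv.refl ℤ))]
  refine finsum_congr fun m => ?_
  have h1 : ∑ i, (f.arrowCongr (Equiv.refl ℤ)) m i = ∑ i, m i :=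
    Equiv.sum_comp f.symm m
  have h2 : ∏ i, coords x ((e i).1, (e i).2, (f.arrowCongr (Equiv.refl ℤ)) m i) =
      ∏ i, coords x (((e ∘ f) i).1, ((e ∘ f) i).2, m i) := by
    rw [← Equiv.prod_comp f]
    simp
  rw [h1, h2]
  rfl

theorem homSeries_mem (M : ℤ) (e : ι → Fin 2 × Fin 2) (c : (ι → ℤ) → ℂ) :
    (fun x : LSL2 => homSeries M e c x.1) ∈ functionals := by
  refine Algebra.subset_adjoin ⟨Fintype.card ι, M, e ∘ (Fintype.equivFin ι).symm,
    fun m => c (m ∘ (Fintype.equivFin ι)), ?_⟩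
  ext x
  rw [homSeries_reindex (Fintype.equivFin ι).symm, ← homSeries_eq_homFunctional]
  rfl

theorem le_of_sum_eq {N M U : ℤ} (hU : M - (Fintype.card ι - 1) * N ≤ U) {m : ι → ℤ}
    (hm : ∀ i, N ≤ m i) (hs : ∑ i, m i = M) (i : ι) : m i ≤ U := by
  classical
  have h1 : (Finset.univ.erase i).card • N ≤ ∑ j ∈ Finset.univ.erase i, m j :=
    Finset.card_nsmul_le_sum _ _ _ fun j _ => hm j
  have h2 := Finset.add_sum_erase Finset.univ m (Finset.mem_univ i)
  have h3 : ((Finset.univ.erase i).card : ℤ) = Fintype.card ι - 1 := by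
    rw [Finset.card_erase_of_mem (Finset.mem_univ i), Finset.card_univ,
      Nat.cast_sub (Fintype.card_pos_iff.2 ⟨i⟩)]
    simp
  rw [nsmul_eq_mul, h3] at h1
  linarith

/-- A term supported above `N` on the hyperplane `∑ m = M` is summed over a box. -/
theorem finsum_eq_sum_box [DecidableEq ι] {N M U : ℤ} (hU : M - (Fintype.card ι - 1) * N ≤ U)
    (g : (ι → ℤ) → ℂ) (hg : ∀ m, g m ≠ 0 → ∀ i, N ≤ m i) :
    (∑ᶠ m : ι → ℤ, if ∑ i, m i = M then g m else 0) =
      ∑ m ∈ Fintype.piFinset fun _ => Finset.Icc N U, if ∑ i, m i = M then g m else 0 := by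
  refine finsum_eq_sum_of_support_subset _ fun m hm => ?_
  simp only [Function.mem_support, ne_eq, ite_eq_right_iff, Classical.not_imp] at hm
  have h1 := hg m hm.2
  simp only [Finset.mem_coe, Fintype.mem_piFinset, Finset.mem_Icc]
  exact fun i => ⟨h1 i, le_of_sum_eq hU h1 hm.1 i⟩

theorem le_of_prod_coords_ne_zero {N : ℤ} {x : LMat} (hx : Lat N x) {e : ι → Fin 2 × Fin 2}
    {m : ι → ℤ} (h : ∏ i, coords x ((e i).1, (e i).2, m i) ≠ 0) (i : ι) : N ≤ m i :=
  not_lt.1 fun hi => h (Finset.prod_eq_zero (Finset.mem_univ i) (hx _ _ _ hi))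

theorem homSeries_eq_sum [DecidableEq ι] {N M U : ℤ} (hU : M - (Fintype.card ι - 1) * N ≤ U)
    (e : ι → Fin 2 × Fin 2) (c : (ι → ℤ) → ℂ) {x : LMat} (hx : Lat N x) :
    homSeries M e c x = ∑ m ∈ Fintype.piFinset fun _ => Finset.Icc N U,
      if ∑ i, m i = M then c m * ∏ i, coords x ((e i).1, (e i).2, m i) else 0 :=
  finsum_eq_sum_box hU _ fun _ h => le_of_prod_coords_ne_zero hx (right_ne_zero_of_mul h)

theorem homSeries_eq_zero {N M : ℤ} (hM : M < Fintype.card ι * N) (e : ι → Fin 2 × Fin 2)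
    (c : (ι → ℤ) → ℂ) {x : LMat} (hx : Lat N x) : homSeries M e c x = 0 := by
  rw [homSeries]
  refine (finsum_congr fun m => ?_).trans finsum_zero
  split_ifs with h
  · by_contra h1
    have h2 := Finset.card_nsmul_le_sum Finset.univ m N fun i _ =>
      le_of_prod_coords_ne_zero hx (right_ne_zero_of_mul h1) i
    rw [Finset.card_univ, nsmul_eq_mul] at h2
    exact absurd (h2.trans_eq h) (not_le.2 hM)
  · rfl

open MvPolynomial in
theorem homSeries_isRegular (M : ℤ) (e : ι → Fin 2 × Fin 2) (c : (ι → ℤ) → ℂ) :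
    IsRegular (homSeries M e c) := fun N => by
  classical
  refine ⟨∑ m ∈ Fintype.piFinset fun _ => Finset.Icc N (M - (Fintype.card ι - 1) * N),
    if ∑ i, m i = M then C (c m) * ∏ i, X ((e i).1, (e i).2, m i) else 0, fun x hx => ?_⟩
  rw [homSeries_eq_sum le_rfl e c hx, map_sum]
  refine Finset.sum_congr rfl fun m _ => ?_
  split_ifs
  · simp [map_prod]
  · simp

/-- Every functional extends to a regular function on all matrices. -/
theorem exists_isRegular {f : LSL2 → ℂ} (hf : f ∈ functionals) :
    ∃ F, IsRegular F ∧ ∀ x : LSL2, f x = F x.1 := by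
  induction hf using Algebra.adjoin_induction with
  | mem f hf =>
    obtain ⟨k, M, e, c, rfl⟩ := hf
    exact ⟨homSeries M e c, homSeries_isRegular M e c, fun x =>
      (homSeries_eq_homFunctional M e c x).symm⟩
  | algebraMap a => exact ⟨fun _ => a, IsRegular.const a, fun _ => rfl⟩
  | add f g _ _ hf hg =>
    obtain ⟨F, hF, hF'⟩ := hf
    obtain ⟨G, hG, hG'⟩ := hg
    exact ⟨F + G, hF.add hG, fun x => by simp [hF', hG']⟩
  | mul f g _ _ hf hg =>
    obtain ⟨F, hF, hF'⟩ := hf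
    obtain ⟨G, hG, hG'⟩ := hg
    exact ⟨F * G, hF.mul hG, fun x => by simp [hF', hG']⟩

end Hom

/-! ### Gradients of regular functions -/

theorem IsLeftGradient.leftGrad_eq {f : LSL2 → ℂ} {x : LSL2} {A : Lsl2 →ₗ[ℂ] ℂ}
    (h : IsLeftGradient f x A) : leftGrad f x = A := by
  have h' : ∃ A, IsLeftGradient f x A := ⟨A, h⟩
  rw [leftGrad, dif_pos h']
  exact h'.choose_spec.unique h

theorem IsRightGradient.rightGrad_eq {f : LSL2 → ℂ} {x : LSL2} {A : Lsl2 →ₗ[ℂ] ℂ}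
    (h : IsRightGradient f x A) : rightGrad f x = A := by
  have h' : ∃ A, IsRightGradient f x A := ⟨A, h⟩
  rw [rightGrad, dif_pos h']
  exact h'.choose_spec.unique h

theorem IsDifferentiable.left {f : LSL2 → ℂ} (hf : IsDifferentiable f) (x : LSL2) :
    IsLeftGradient f x (leftGrad f x) := by
  obtain ⟨A, hA⟩ := (hf x).1
  rwa [hA.leftGrad_eq]

theorem IsDifferentiable.right {f : LSL2 → ℂ} (hf : IsDifferentiable f) (x : LSL2) :
    IsRightGradient f x (rightGrad f x) := by
  obtain ⟨A, hA⟩ := (hf x).2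
  rwa [hA.rightGrad_eq]

theorem hasCoeffDeriv_eval_mul {γ : PolyCurve} {ξ : Lsl2} (h : γ.IsTangent ξ) (x : LSL2) :
    HasCoeffDeriv (fun t => (γ.eval t * x).1) (ξ.1 * x.1) := h.hasCoeffDeriv.mul_right x.1

theorem hasCoeffDeriv_mul_eval {γ : PolyCurve} {ξ : Lsl2} (h : γ.IsTangent ξ) (x : LSL2) :
    HasCoeffDeriv (fun t => (x * γ.eval t).1) (x.1 * ξ.1) := h.hasCoeffDeriv.mul_left x.1

theorem PolyCurve.IsTangent.eval_zero {γ : PolyCurve} {ξ : Lsl2} (h : γ.IsTangent ξ) :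
    γ.eval 0 = 1 := by
  apply Subtype.ext
  ext1 i j
  have h1 : (γ.eval 0).1 i j = (γ.1 i j).eval (HahnSeries.C (0 : ℂ) : Loop) := rfl
  rw [h1, map_zero, ← Polynomial.coeff_zero_eq_eval_zero, (h i j).1]
  rfl

theorem lmat_smul_mul (c : ℂ) (x y : LMat) : c • x * y = c • (x * y) := by
  ext1 i j
  simp only [Matrix.mul_apply, Matrix.smul_apply, Fin.sum_univ_two, loop_smul_mul, smul_add]

theorem lmat_mul_smul (c : ℂ) (x y : LMat) : x * c • y = c • (x * y) := by
  ext1 i j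
  simp only [Matrix.mul_apply, Matrix.smul_apply, Fin.sum_univ_two, loop_mul_smul, smul_add]

/-- The velocity `ξx` of left translations. -/
def leftAct (x : LMat) : Lsl2 →ₗ[ℂ] LMat where
  toFun ξ := ξ.1 * x
  map_add' ξ ζ := add_mul ξ.1 ζ.1 x
  map_smul' c ξ := lmat_smul_mul c ξ.1 x

/-- The velocity `xξ` of right translations. -/
def rightAct (x : LMat) : Lsl2 →ₗ[ℂ] LMat where
  toFun ξ := x * ξ.1
  map_add' ξ ζ := mul_add x ξ.1 ζ.1
  map_smul' c ξ := lmat_mul_smul c x ξ.1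

@[simp] theorem leftAct_apply (x : LMat) (ξ : Lsl2) : leftAct x ξ = ξ.1 * x := rfl
@[simp] theorem rightAct_apply (x : LMat) (ξ : Lsl2) : rightAct x ξ = x * ξ.1 := rfl

/-- A linear map into matrices that maps deep lattices into deep lattices. -/
def LatContinuous (l : Lsl2 →ₗ[ℂ] LMat) : Prop := ∃ N, ∀ K ξ, Lat K ξ.1 → Lat (K + N) (l ξ)

theorem leftAct_continuous (x : LMat) : LatContinuous (leftAct x) := by
  obtain ⟨N, hN⟩ := exists_lat x
  exact ⟨N, fun K ξ h => h.mul hN⟩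

theorem rightAct_continuous (x : LMat) : LatContinuous (rightAct x) := by
  obtain ⟨N, hN⟩ := exists_lat x
  exact ⟨N, fun K ξ h => add_comm N K ▸ hN.mul h⟩

namespace IsRegular
variable {F : LMat → ℂ}

/-- The derivative of a regular function as a linear map. -/
def dirLin (hF : IsRegular F) (x : LMat) : LMat →ₗ[ℂ] ℂ where
  toFun y := dirDeriv F x y
  map_add' := hF.dirDeriv_add x
  map_smul' c y := hF.dirDeriv_smul c x y

/-- The second derivative of a regular function as a linear map of its last argument. -/
def dirLin₂ (hF : IsRegular F) (x y : LMat) : LMat →ₗ[ℂ] ℂ where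
  toFun z := dirDeriv₂ F x y z
  map_add' := hF.dirDeriv₂_add x y
  map_smul' c z := hF.dirDeriv₂_smul c x y z

@[simp] theorem dirLin_apply (hF : IsRegular F) (x y : LMat) :
    hF.dirLin x y = dirDeriv F x y := rfl
@[simp] theorem dirLin₂_apply (hF : IsRegular F) (x y z : LMat) :
    hF.dirLin₂ x y z = dirDeriv₂ F x y z := rfl

theorem dirLin_continuous (hF : IsRegular F) (x : LMat) {l : Lsl2 →ₗ[ℂ] LMat}
    (hl : LatContinuous l) : SAdicContinuous (hF.dirLin x ∘ₗ l) := by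
  obtain ⟨N, hN⟩ := hl
  obtain ⟨M, hM⟩ := exists_lat x
  obtain ⟨K, hK⟩ := hF.exists_continuous M
  exact ⟨K - N, fun ξ h => hK _ _ hM (by simpa using hN _ ξ h)⟩

theorem isLeftGradient (hF : IsRegular F) (x : LSL2) :
    IsLeftGradient (fun x => F x.1) x (hF.dirLin x.1 ∘ₗ leftAct x.1) := by
  refine ⟨hF.dirLin_continuous _ (leftAct_continuous _), fun ξ γ hγ => ?_⟩
  have := hF.hasDerivAt_comp (hasCoeffDeriv_eval_mul hγ x)
  rwa [hγ.eval_zero, one_mul] at this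

theorem isRightGradient (hF : IsRegular F) (x : LSL2) :
    IsRightGradient (fun x => F x.1) x (hF.dirLin x.1 ∘ₗ rightAct x.1) := by
  refine ⟨hF.dirLin_continuous _ (rightAct_continuous _), fun ξ γ hγ => ?_⟩
  have := hF.hasDerivAt_comp (hasCoeffDeriv_mul_eval hγ x)
  rwa [hγ.eval_zero, mul_one] at this

theorem isDifferentiable (hF : IsRegular F) : IsDifferentiable fun x => F x.1 :=
  fun x => ⟨⟨_, hF.isLeftGradient x⟩, ⟨_, hF.isRightGradient x⟩⟩

end IsRegular

theorem isDifferentiable_of_mem {f : LSL2 → ℂ} (hf : f ∈ functionals) : IsDifferentiable f := by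
  obtain ⟨F, hF, h⟩ := exists_isRegular hf
  rw [show f = fun x : LSL2 => F x.1 from funext h]
  exact hF.isDifferentiable

/-! ### Bilinearity and the Leibniz rule -/

theorem SAdicContinuous.zero : SAdicContinuous 0 := ⟨0, fun _ _ => rfl⟩

theorem SAdicContinuous.add {A B : Lsl2 →ₗ[ℂ] ℂ} (hA : SAdicContinuous A)
    (hB : SAdicContinuous B) : SAdicContinuous (A + B) := by
  obtain ⟨N, hN⟩ := hA
  obtain ⟨M, hM⟩ := hB
  refine ⟨max N M, fun ξ h => ?_⟩
  rw [LinearMap.add_apply, hN ξ fun i j n hn => h i j n (hn.trans_le (le_max_left _ _)),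
    hM ξ fun i j n hn => h i j n (hn.trans_le (le_max_right _ _)), add_zero]

theorem SAdicContinuous.smul {A : Lsl2 →ₗ[ℂ] ℂ} (c : ℂ) (hA : SAdicContinuous A) :
    SAdicContinuous (c • A) := by
  obtain ⟨N, hN⟩ := hA
  exact ⟨N, fun ξ h => by rw [LinearMap.smul_apply, hN ξ h, smul_zero]⟩

theorem SAdicContinuous.neg {A : Lsl2 →ₗ[ℂ] ℂ} (hA : SAdicContinuous A) :
    SAdicContinuous (-A) := by
  rw [← neg_one_smul ℂ]; exact hA.smul _

theorem SAdicContinuous.comp_tauLie {A : Lsl2 →ₗ[ℂ] ℂ} (hA : SAdicContinuous A) (q : ℂˣ) :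
    SAdicContinuous (A ∘ₗ tauLie q) := by
  obtain ⟨N, hN⟩ := hA
  refine ⟨N, fun ξ h => hN _ fun i j n hn => ?_⟩
  change (q : ℂ) ^ n * _ = 0
  rw [h i j n hn, mul_zero]

section rPair
variable (φ : ℤ → ℂ) {A B C : Lsl2 →ₗ[ℂ] ℂ}

theorem rOp_add (a b : LMat) : rOp φ (a + b) = rOp φ a + rOp φ b := by
  ext1 i j
  fin_cases i <;> fin_cases j <;> simp [rOp]; ring

theorem rOp_smul (c : ℂ) (a : LMat) : rOp φ (c • a) = c • rOp φ a := by
  ext1 i j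
  fin_cases i <;> fin_cases j <;> simp [rOp]

theorem rPair_add_left (hA : SAdicContinuous A) (hB : SAdicContinuous B)
    (hC : SAdicContinuous C) : rPair φ (A + B) C = rPair φ A C + rPair φ B C := by
  obtain ⟨a, ha⟩ := exists_dual hA
  obtain ⟨b, hb⟩ := exists_dual hB
  obtain ⟨c, hc⟩ := exists_dual hC
  rw [rPair_eq φ ha hc, rPair_eq φ hb hc, ← trc_add_left]
  exact rPair_eq φ (a := a + b) (fun ξ => by
    rw [LinearMap.add_apply, ha, hb, ← trc_add_left]; rfl) hc

theorem rPair_add_right (hA : SAdicContinuous A) (hB : SAdicContinuous B)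
    (hC : SAdicContinuous C) : rPair φ C (A + B) = rPair φ C A + rPair φ C B := by
  obtain ⟨a, ha⟩ := exists_dual hA
  obtain ⟨b, hb⟩ := exists_dual hB
  obtain ⟨c, hc⟩ := exists_dual hC
  rw [rPair_eq φ hc ha, rPair_eq φ hc hb, ← trc_add_right, ← rOp_add]
  exact rPair_eq φ (b := a + b) hc (fun ξ => by
    rw [LinearMap.add_apply, ha, hb, ← trc_add_left]; rfl)

theorem rPair_smul_left (t : ℂ) (hA : SAdicContinuous A) (hC : SAdicContinuous C) :
    rPair φ (t • A) C = t * rPair φ A C := by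
  obtain ⟨a, ha⟩ := exists_dual hA
  obtain ⟨c, hc⟩ := exists_dual hC
  rw [rPair_eq φ ha hc, ← trc_smul_left]
  exact rPair_eq φ (a := t • a) (fun ξ => by
    rw [LinearMap.smul_apply, ha, smul_eq_mul, ← trc_smul_left]; rfl) hc

theorem rPair_smul_right (t : ℂ) (hA : SAdicContinuous A) (hC : SAdicContinuous C) :
    rPair φ C (t • A) = t * rPair φ C A := by
  obtain ⟨a, ha⟩ := exists_dual hA
  obtain ⟨c, hc⟩ := exists_dual hC
  rw [rPair_eq φ hc ha, ← trc_smul_right, ← rOp_smul]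
  exact rPair_eq φ (b := t • a) hc (fun ξ => by
    rw [LinearMap.smul_apply, ha, smul_eq_mul, ← trc_smul_left]; rfl)

end rPair

/-- The value of a bracket on functions with gradients `(A, B)` and `(C, D)`. The parameters
`σ = -1`, `κ = 0` give `η`, and `σ = κ = 1` give `η_*^q`. -/
def genPair (q : ℂˣ) (φ : ℤ → ℂ) (σ κ : ℂ) (A B C D : Lsl2 →ₗ[ℂ] ℂ) : ℂ :=
  rWedge φ A C + σ * rWedge φ B D - κ * (rTwist q φ B C - rTwist q φ D A)

/-- A common form of the brackets `η` and `η_*^q`. -/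
def genBracket (q : ℂˣ) (φ : ℤ → ℂ) (σ κ : ℂ) : Bracket := fun f h x =>
  genPair q φ σ κ (leftGrad f x) (rightGrad f x) (leftGrad h x) (rightGrad h x)

theorem etaBracket_eq (φ : ℤ → ℂ) : etaBracket φ = genBracket 1 φ (-1) 0 := by
  funext f h x
  simp [etaBracket, genBracket, genPair, sub_eq_add_neg]

theorem etaStarBracket_eq (q : ℂˣ) (φ : ℤ → ℂ) : etaStarBracket q φ = genBracket q φ 1 1 := by
  funext f h x
  simp [etaStarBracket, genBracket, genPair]

section genPair
variable (q : ℂˣ) (φ : ℤ → ℂ) (σ κ : ℂ) {A B C D A' B' : Lsl2 →ₗ[ℂ] ℂ}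

theorem genPair_skew (A B C D : Lsl2 →ₗ[ℂ] ℂ) :
    genPair q φ σ κ A B C D = -genPair q φ σ κ C D A B := by
  simp only [genPair, rWedge]
  ring

theorem genPair_add_left (hA : SAdicContinuous A) (hB : SAdicContinuous B)
    (hA' : SAdicContinuous A') (hB' : SAdicContinuous B') (hC : SAdicContinuous C)
    (hD : SAdicContinuous D) : genPair q φ σ κ (A + A') (B + B') C D =
      genPair q φ σ κ A B C D + genPair q φ σ κ A' B' C D := by
  simp only [genPair, rWedge, rTwist, LinearMap.add_comp]
  rw [rPair_add_left φ hA hA' hC, rPair_add_right φ hA hA' hC, rPair_add_left φ hB hB' hD,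
    rPair_add_right φ hB hB' hD, rPair_add_left φ hB hB' (hC.comp_tauLie q),
    rPair_add_right φ (hA.comp_tauLie q) (hA'.comp_tauLie q) hD]
  ring

theorem genPair_smul_left (t : ℂ) (hA : SAdicContinuous A) (hB : SAdicContinuous B)
    (hC : SAdicContinuous C) (hD : SAdicContinuous D) :
    genPair q φ σ κ (t • A) (t • B) C D = t * genPair q φ σ κ A B C D := by
  simp only [genPair, rWedge, rTwist, LinearMap.smul_comp]
  rw [rPair_smul_left φ t hA hC, rPair_smul_right φ t hA hC, rPair_smul_left φ t hB hD,
    rPair_smul_right φ t hB hD, rPair_smul_left φ t hB (hC.comp_tauLie q),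
    rPair_smul_right φ t (hA.comp_tauLie q) hD]
  ring

end genPair

section gradients
variable {f g : LSL2 → ℂ} {x : LSL2} {A B : Lsl2 →ₗ[ℂ] ℂ}

theorem IsLeftGradient.add (hA : IsLeftGradient f x A) (hB : IsLeftGradient g x B) :
    IsLeftGradient (f + g) x (A + B) :=
  ⟨hA.1.add hB.1, fun ξ γ hγ => (hA.2 ξ γ hγ).add (hB.2 ξ γ hγ)⟩

theorem IsRightGradient.add (hA : IsRightGradient f x A) (hB : IsRightGradient g x B) :
    IsRightGradient (f + g) x (A + B) :=
  ⟨hA.1.add hB.1, fun ξ γ hγ => (hA.2 ξ γ hγ).add (hB.2 ξ γ hγ)⟩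

theorem IsLeftGradient.smul (c : ℂ) (hA : IsLeftGradient f x A) :
    IsLeftGradient (c • f) x (c • A) :=
  ⟨hA.1.smul c, fun ξ γ hγ => (hA.2 ξ γ hγ).const_mul c⟩

theorem IsRightGradient.smul (c : ℂ) (hA : IsRightGradient f x A) :
    IsRightGradient (c • f) x (c • A) :=
  ⟨hA.1.smul c, fun ξ γ hγ => (hA.2 ξ γ hγ).const_mul c⟩

theorem IsLeftGradient.mul (hA : IsLeftGradient f x A) (hB : IsLeftGradient g x B) :
    IsLeftGradient (f * g) x (g x • A + f x • B) :=
  ⟨(hA.1.smul _).add (hB.1.smul _), fun ξ γ hγ => by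
    refine ((hA.2 ξ γ hγ).mul (hB.2 ξ γ hγ)).congr_deriv ?_
    simp only [hγ.eval_zero, one_mul, LinearMap.add_apply, LinearMap.smul_apply, smul_eq_mul]
    ring⟩

theorem IsRightGradient.mul (hA : IsRightGradient f x A) (hB : IsRightGradient g x B) :
    IsRightGradient (f * g) x (g x • A + f x • B) :=
  ⟨(hA.1.smul _).add (hB.1.smul _), fun ξ γ hγ => by
    refine ((hA.2 ξ γ hγ).mul (hB.2 ξ γ hγ)).congr_deriv ?_
    simp only [hγ.eval_zero, mul_one, LinearMap.add_apply, LinearMap.smul_apply, smul_eq_mul]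
    ring⟩

theorem isLeftGradient_const (c : ℂ) (x : LSL2) : IsLeftGradient (fun _ => c) x 0 :=
  ⟨SAdicContinuous.zero, fun _ _ _ => hasDerivAt_const _ _⟩

theorem isRightGradient_const (c : ℂ) (x : LSL2) : IsRightGradient (fun _ => c) x 0 :=
  ⟨SAdicContinuous.zero, fun _ _ _ => hasDerivAt_const _ _⟩

end gradients

section genBracket
variable (q : ℂˣ) (φ : ℤ → ℂ) (σ κ : ℂ) {f g h : LSL2 → ℂ}

theorem genBracket_skew (f g : LSL2 → ℂ) :
    genBracket q φ σ κ f g = -genBracket q φ σ κ g f :=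
  funext fun _ => genPair_skew q φ σ κ _ _ _ _

theorem genBracket_add_left (hf : IsDifferentiable f) (hg : IsDifferentiable g)
    (hh : IsDifferentiable h) : genBracket q φ σ κ (f + g) h =
      genBracket q φ σ κ f h + genBracket q φ σ κ g h := by
  funext x
  rw [genBracket, ((hf.left x).add (hg.left x)).leftGrad_eq,
    ((hf.right x).add (hg.right x)).rightGrad_eq]
  exact genPair_add_left q φ σ κ (hf.left x).1 (hf.right x).1 (hg.left x).1 (hg.right x).1
    (hh.left x).1 (hh.right x).1

theorem genBracket_smul_left (c : ℂ) (hf : IsDifferentiable f) (hh : IsDifferentiable h) :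
    genBracket q φ σ κ (c • f) h = c • genBracket q φ σ κ f h := by
  funext x
  rw [genBracket, ((hf.left x).smul c).leftGrad_eq, ((hf.right x).smul c).rightGrad_eq]
  exact genPair_smul_left q φ σ κ c (hf.left x).1 (hf.right x).1 (hh.left x).1 (hh.right x).1

theorem genBracket_mul_left (hf : IsDifferentiable f) (hg : IsDifferentiable g)
    (hh : IsDifferentiable h) : genBracket q φ σ κ (f * g) h =
      genBracket q φ σ κ f h * g + f * genBracket q φ σ κ g h := by
  funext x
  rw [genBracket, ((hf.left x).mul (hg.left x)).leftGrad_eq,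
    ((hf.right x).mul (hg.right x)).rightGrad_eq,
    genPair_add_left q φ σ κ ((hf.left x).1.smul _) ((hf.right x).1.smul _) ((hg.left x).1.smul _)
      ((hg.right x).1.smul _) (hh.left x).1 (hh.right x).1,
    genPair_smul_left q φ σ κ _ (hf.left x).1 (hf.right x).1 (hh.left x).1 (hh.right x).1,
    genPair_smul_left q φ σ κ _ (hg.left x).1 (hg.right x).1 (hh.left x).1 (hh.right x).1]
  simp only [Pi.add_apply, Pi.mul_apply, genBracket]
  ring

theorem genBracket_const_left (c : ℂ) (hh : IsDifferentiable h) :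
    genBracket q φ σ κ (fun _ => c) h = 0 := by
  funext x
  rw [genBracket, (isLeftGradient_const c x).leftGrad_eq, (isRightGradient_const c x).rightGrad_eq]
  have := genPair_smul_left q φ σ κ 0 SAdicContinuous.zero SAdicContinuous.zero (hh.left x).1
    (hh.right x).1
  simpa using this

/-- A bracket that is a biderivation preserves the functionals as soon as it maps pairs of the
generators to functionals. -/
theorem genBracket_mem_of_hom
    (H : ∀ (k k' : ℕ) (M M' : ℤ) (e : Fin k → Fin 2 × Fin 2) (e' : Fin k' → Fin 2 × Fin 2)
      (c : (Fin k → ℤ) → ℂ) (c' : (Fin k' → ℤ) → ℂ),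
      genBracket q φ σ κ (homFunctional M e c) (homFunctional M' e' c') ∈ functionals)
    (hf : f ∈ functionals) (hg : g ∈ functionals) : genBracket q φ σ κ f g ∈ functionals := by
  have key : ∀ g ∈ functionals, (∀ (k : ℕ) (M : ℤ) (e : Fin k → Fin 2 × Fin 2)
      (c : (Fin k → ℤ) → ℂ), genBracket q φ σ κ (homFunctional M e c) g ∈ functionals) →
      ∀ f ∈ functionals, genBracket q φ σ κ f g ∈ functionals := by
    intro g hg hgen f hf
    have hg' := isDifferentiable_of_mem hg
    induction hf using Algebra.adjoin_induction with
    | mem f hf =>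
      obtain ⟨k, M, e, c, rfl⟩ := hf
      exact hgen k M e c
    | algebraMap a =>
      rw [show (algebraMap ℂ (LSL2 → ℂ)) a = fun _ => a from rfl,
        genBracket_const_left q φ σ κ a hg']
      exact zero_mem _
    | add f₁ f₂ h₁ h₂ hf₁ hf₂ =>
      rw [genBracket_add_left q φ σ κ (isDifferentiable_of_mem h₁) (isDifferentiable_of_mem h₂) hg']
      exact add_mem hf₁ hf₂
    | mul f₁ f₂ h₁ h₂ hf₁ hf₂ =>
      rw [genBracket_mul_left q φ σ κ (isDifferentiable_of_mem h₁) (isDifferentiable_of_mem h₂) hg']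
      exact add_mem (mul_mem hf₁ h₂) (mul_mem h₁ hf₂)
  have hom_mem : ∀ (k : ℕ) (M : ℤ) (e : Fin k → Fin 2 × Fin 2) (c : (Fin k → ℤ) → ℂ),
      homFunctional M e c ∈ functionals := fun k M e c => Algebra.subset_adjoin ⟨k, M, e, c, rfl⟩
  refine key g hg (fun k M e c => ?_) f hf
  rw [genBracket_skew]
  refine neg_mem (key _ (hom_mem k M e c) (fun k' M' e' c' => ?_) g hg)
  exact H k' k M' M e' e c' c

end genBracket

/-! ### The brackets of homogeneous functionals -/

section Hom
variable {ι ι' : Type} [Fintype ι] [Fintype ι'] [DecidableEq ι] [DecidableEq ι']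

theorem dirDeriv_homSeries (M : ℤ) (e : ι → Fin 2 × Fin 2) (c : (ι → ℤ) → ℂ) (x y : LMat) :
    dirDeriv (homSeries M e c) x y = ∑ i, ∑ᶠ m : ι → ℤ, if ∑ i, m i = M then
      c m * ((∏ j ∈ Finset.univ.erase i, coords x ((e j).1, (e j).2, m j)) *
        coords y ((e i).1, (e i).2, m i)) else 0 := by
  obtain ⟨N, hx, hy⟩ := exists_lat₂ x y
  have h1 : ∀ i, (∑ᶠ m : ι → ℤ, if ∑ i, m i = M then
      c m * ((∏ j ∈ Finset.univ.erase i, coords x ((e j).1, (e j).2, m j)) *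
        coords y ((e i).1, (e i).2, m i)) else 0) = _ := fun i =>
    finsum_eq_sum_box (N := N) le_rfl _ fun m hm j => by
      have h2 := right_ne_zero_of_mul hm
      by_cases hj : j = i
      · exact not_lt.1 fun h => right_ne_zero_of_mul h2 (hj ▸ hy _ _ _ h)
      · exact not_lt.1 fun h => left_ne_zero_of_mul h2
          (Finset.prod_eq_zero (i := j) (by simp [hj]) (hx _ _ _ h))
  simp only [h1]
  rw [Finset.sum_comm, dirDeriv]
  have h3 : ∀ t : ℂ, homSeries M e c (x + t • y) = _ := fun t =>
    homSeries_eq_sum (N := N) le_rfl e c (hx.add (hy.smul t))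
  simp only [h3]
  refine HasDerivAt.deriv (HasDerivAt.fun_sum fun m _ => ?_)
  split_ifs with hm
  · rw [← Finset.mul_sum]
    refine HasDerivAt.const_mul _ ?_
    refine (HasDerivAt.fun_finsetProd (u := Finset.univ) fun i _ =>
      (HasCoeffDeriv.line x y).2 ((e i).1, (e i).2, m i)).congr_deriv ?_
    refine Finset.sum_congr rfl fun i _ => ?_
    simp only [add_zero_smul_lmat, smul_eq_mul]
  · simpa using hasDerivAt_const (0 : ℂ) (0 : ℂ)

/-- The family of vector fields `Y n` multiplies the matrix entries by constants, permutes them,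
and shifts the Fourier modes by `n`. -/
def IsShift (w : Fin 2 × Fin 2 → ℂ) (σ : Fin 2 × Fin 2 → Fin 2 × Fin 2)
    (Y : ℤ → LMat → LMat) : Prop :=
  ∀ n x i m, coords (Y n x) (i.1, i.2, m) = w i * coords x ((σ i).1, (σ i).2, m - n)

/-- A shifting vector field maps homogeneous functionals to homogeneous functionals. -/
theorem dirDeriv_homSeries_shift {w : Fin 2 × Fin 2 → ℂ} {σ : Fin 2 × Fin 2 → Fin 2 × Fin 2}
    {Y : ℤ → LMat → LMat} (hY : IsShift w σ Y) (M : ℤ) (e : ι → Fin 2 × Fin 2)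
    (c : (ι → ℤ) → ℂ) (n : ℤ) (x : LMat) :
    dirDeriv (homSeries M e c) x (Y n x) = ∑ i, w (e i) *
      homSeries (M - n) (Function.update e i (σ (e i))) (fun m => c (m + Pi.single i n)) x := by
  rw [dirDeriv_homSeries]
  refine Finset.sum_congr rfl fun i _ => ?_
  rw [homSeries, ← smul_eq_mul, smul_finsum, ← finsum_comp_equiv (Equiv.addRight (Pi.single i n))]
  refine finsum_congr fun m => ?_
  have h1 : ∑ j, (m + Pi.single i n : ι → ℤ) j = ∑ j, m j + n := by
    simp [Finset.sum_add_distrib]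
  have h2 : ∏ j ∈ Finset.univ.erase i, coords x ((e j).1, (e j).2, (m + Pi.single i n : ι → ℤ) j) =
      ∏ j ∈ Finset.univ.erase i, coords x ((Function.update e i (σ (e i)) j).1,
        (Function.update e i (σ (e i)) j).2, m j) := by
    refine Finset.prod_congr rfl fun j hj => ?_
    have hj' : j ≠ i := Finset.ne_of_mem_erase hj
    simp [hj']
  rw [Equiv.coe_addRight, h1, h2, hY, ← Finset.prod_erase_mul _ _ (Finset.mem_univ i)]
  simp only [eq_sub_iff_add_eq, Pi.add_apply, Pi.single_eq_same, add_sub_cancel_right,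
    Function.update_self, smul_eq_mul]
  split_ifs <;> ring

/-- Summing products of homogeneous functionals of opposite shifts gives a homogeneous
functional: the shift is determined by the degree of the first factor. -/
theorem finsum_homSeries_mul (M M' : ℤ) (e : ι → Fin 2 × Fin 2) (e' : ι' → Fin 2 × Fin 2)
    (c : ℤ → (ι → ℤ) → ℂ) (c' : ℤ → (ι' → ℤ) → ℂ) (x : LMat) :
    (Function.support fun n : ℤ => homSeries (M - n) e (c n) x *
      homSeries (M' + n) e' (c' n) x).Finite ∧
    ∑ᶠ n : ℤ, homSeries (M - n) e (c n) x * homSeries (M' + n) e' (c' n) x =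
      homSeries (M + M') (Sum.elim e e') (fun m => c (M - ∑ i, m (Sum.inl i)) (m ∘ Sum.inl) *
        c' (M - ∑ i, m (Sum.inl i)) (m ∘ Sum.inr)) x := by
  obtain ⟨N, hx⟩ := exists_lat x
  -- Below `n₀` the second factor vanishes, and above `n₁` the first one does.
  set n₀ : ℤ := Fintype.card ι' * N - M' with hn₀
  set n₁ : ℤ := M - Fintype.card ι * N with hn₁
  have hsupp : (Function.support fun n : ℤ => homSeries (M - n) e (c n) x *
      homSeries (M' + n) e' (c' n) x) ⊆ Finset.Icc n₀ n₁ := by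
    intro n hn
    rw [Finset.coe_Icc, Set.mem_Icc]
    constructor
    · by_contra h
      exact hn (mul_eq_zero_of_right _ (homSeries_eq_zero (by omega) e' (c' n) hx))
    · by_contra h
      exact hn (mul_eq_zero_of_left (homSeries_eq_zero (by omega) e (c n) hx) _)
  refine ⟨(Finset.finite_toSet _).subset hsupp, ?_⟩
  rw [finsum_eq_sum_of_support_subset _ hsupp]
  obtain ⟨U, hU, hU', hU''⟩ : ∃ U, M - n₀ - (Fintype.card ι - 1) * N ≤ U ∧
      M' + n₁ - (Fintype.card ι' - 1) * N ≤ U ∧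
      M + M' - (Fintype.card (ι ⊕ ι') - 1) * N ≤ U :=
    ⟨max (max _ _) _, (le_max_left _ _).trans (le_max_left _ _),
      (le_max_right _ _).trans (le_max_left _ _), le_max_right _ _⟩
  rw [homSeries_eq_sum hU'' _ _ hx]
  have h1 : ∀ n ∈ Finset.Icc n₀ n₁, homSeries (M - n) e (c n) x * homSeries (M' + n) e' (c' n) x =
      ∑ m ∈ Fintype.piFinset fun _ => Finset.Icc N U,
      ∑ m' ∈ Fintype.piFinset fun _ => Finset.Icc N U,
        if n = M - ∑ i, m i ∧ ∑ i, m i + ∑ i, m' i = M + M' then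
          c (M - ∑ i, m i) m * (∏ i, coords x ((e i).1, (e i).2, m i)) *
          (c' (M - ∑ i, m i) m' * (∏ i, coords x ((e' i).1, (e' i).2, m' i))) else 0 := by
    intro n hn
    rw [Finset.mem_Icc] at hn
    rw [homSeries_eq_sum (U := U) (by linarith) e (c n) hx,
      homSeries_eq_sum (U := U) (by linarith) e' (c' n) hx, Finset.sum_mul_sum]
    refine Finset.sum_congr rfl fun m _ => Finset.sum_congr rfl fun m' _ => ?_
    by_cases h : ∑ i, m i = M - n
    · have h2 : M - ∑ i, m i = n := by omega
      have h3 : (M - n + ∑ i, m' i = M + M') ↔ (∑ i, m' i = M' + n) := by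
        constructor <;> intro <;> omega
      simp only [h, sub_sub_cancel, h3, true_and, if_true]
      split_ifs <;> simp
    · rw [if_neg h, zero_mul, if_neg]
      rintro ⟨h2, -⟩
      exact h (by omega)
  rw [Finset.sum_congr rfl h1, Finset.sum_comm]
  have h4 : ∀ m ∈ (Fintype.piFinset fun _ : ι => Finset.Icc N U),
      (∑ n ∈ Finset.Icc n₀ n₁, ∑ m' ∈ Fintype.piFinset fun _ : ι' => Finset.Icc N U,
        if n = M - ∑ i, m i ∧ ∑ i, m i + ∑ i, m' i = M + M' then
          c (M - ∑ i, m i) m * (∏ i, coords x ((e i).1, (e i).2, m i)) *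
          (c' (M - ∑ i, m i) m' * (∏ i, coords x ((e' i).1, (e' i).2, m' i))) else 0) =
      ∑ m' ∈ Fintype.piFinset fun _ : ι' => Finset.Icc N U,
        if ∑ i, m i + ∑ i, m' i = M + M' then
          c (M - ∑ i, m i) m * (∏ i, coords x ((e i).1, (e i).2, m i)) *
          (c' (M - ∑ i, m i) m' * (∏ i, coords x ((e' i).1, (e' i).2, m' i))) else 0 := by
    intro m hm
    rw [Finset.sum_comm]
    refine Finset.sum_congr rfl fun m' hm' => ?_
    split_ifs with h
    · simp only [h, and_true]
      rw [Finset.sum_ite_eq', if_pos]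
      have b1 := Finset.card_nsmul_le_sum Finset.univ m N fun i _ =>
        (Finset.mem_Icc.1 (Fintype.mem_piFinset.1 hm i)).1
      have b2 := Finset.card_nsmul_le_sum Finset.univ m' N fun i _ =>
        (Finset.mem_Icc.1 (Fintype.mem_piFinset.1 hm' i)).1
      rw [Finset.card_univ, nsmul_eq_mul] at b1 b2
      rw [Finset.mem_Icc]
      constructor <;> linarith
    · simp [h]
  rw [Finset.sum_congr rfl h4, ← Finset.sum_product']
  refine (Finset.sum_equiv (Equiv.sumArrowEquivProdArrow ι ι' ℤ) (fun m => ?_) fun m _ => ?_).symm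
  · simp [Equiv.sumArrowEquivProdArrow]
  · simp only [Fintype.sum_sum_type, Fintype.prod_sum_type, Sum.elim_inl, Sum.elim_inr]
    change _ = if ∑ i, m (Sum.inl i) + ∑ i, m (Sum.inr i) = M + M' then
          c (M - ∑ i, m (Sum.inl i)) (m ∘ Sum.inl) *
            (∏ i, coords x ((e i).1, (e i).2, m (Sum.inl i))) *
          (c' (M - ∑ i, m (Sum.inl i)) (m ∘ Sum.inr) *
            (∏ i, coords x ((e' i).1, (e' i).2, m (Sum.inr i)))) else 0
    split_ifs
    · ring
    · rfl

/-- One mode sum of a bracket of two homogeneous functionals is a functional. -/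
theorem finsum_shift_mem {w w' : Fin 2 × Fin 2 → ℂ} {σ σ' : Fin 2 × Fin 2 → Fin 2 × Fin 2}
    {Y Y' : ℤ → LMat → LMat} (hY : IsShift w σ Y) (hY' : IsShift w' σ' Y') (ψ : ℤ → ℂ)
    (M M' : ℤ) (e : ι → Fin 2 × Fin 2) (e' : ι' → Fin 2 × Fin 2) (c : (ι → ℤ) → ℂ)
    (c' : (ι' → ℤ) → ℂ) :
    (fun x : LSL2 => ∑ᶠ n : ℤ, ψ n * (dirDeriv (homSeries M e c) x.1 (Y n x.1) *
      dirDeriv (homSeries M' e' c') x.1 (Y' (-n) x.1))) ∈ functionals := by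
  have h1 : ∀ (x : LMat) (n : ℤ), ψ n * (dirDeriv (homSeries M e c) x (Y n x) *
      dirDeriv (homSeries M' e' c') x (Y' (-n) x)) = ∑ i, ∑ i', w (e i) * w' (e' i') *
        (homSeries (M - n) (Function.update e i (σ (e i))) (fun m => ψ n * c (m + Pi.single i n)) x *
        homSeries (M' + n) (Function.update e' i' (σ' (e' i')))
          (fun m => c' (m + Pi.single i' (-n))) x) := by
    intro x n
    rw [dirDeriv_homSeries_shift hY, dirDeriv_homSeries_shift hY', Finset.sum_mul_sum,
      Finset.mul_sum]
    refine Finset.sum_congr rfl fun i _ => ?_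
    rw [Finset.mul_sum]
    refine Finset.sum_congr rfl fun i' _ => ?_
    have h2 : homSeries (M - n) (Function.update e i (σ (e i)))
        (fun m => ψ n * c (m + Pi.single i n)) x = ψ n *
        homSeries (M - n) (Function.update e i (σ (e i))) (fun m => c (m + Pi.single i n)) x := by
      rw [homSeries, homSeries, ← smul_eq_mul (ψ n), smul_finsum]
      exact finsum_congr fun m => by split_ifs <;> simp [mul_assoc]
    rw [h2, sub_neg_eq_add]
    ring
  have h3 : (fun x : LSL2 => ∑ᶠ n : ℤ, ψ n * (dirDeriv (homSeries M e c) x.1 (Y n x.1) *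
      dirDeriv (homSeries M' e' c') x.1 (Y' (-n) x.1))) = ∑ i, ∑ i', (w (e i) * w' (e' i')) •
      fun x : LSL2 => homSeries (M + M') (Sum.elim (Function.update e i (σ (e i)))
        (Function.update e' i' (σ' (e' i')))) (fun m =>
          (ψ (M - ∑ j, m (Sum.inl j)) *
            c (m ∘ Sum.inl + Pi.single i (M - ∑ j, m (Sum.inl j)))) *
          c' (m ∘ Sum.inr + Pi.single i' (-(M - ∑ j, m (Sum.inl j))))) x.1 := by
    funext x
    simp only [h1, Finset.sum_apply, Pi.smul_apply, smul_eq_mul]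
    have h4 := fun i i' => finsum_homSeries_mul M M' (Function.update e i (σ (e i)))
      (Function.update e' i' (σ' (e' i'))) (fun n m => ψ n * c (m + Pi.single i n))
      (fun n m => c' (m + Pi.single i' (-n))) x.1
    have h5 : ∀ i i', (Function.support fun n : ℤ => w (e i) * w' (e' i') *
        (homSeries (M - n) (Function.update e i (σ (e i)))
          (fun m => ψ n * c (m + Pi.single i n)) x.1 *
        homSeries (M' + n) (Function.update e' i' (σ' (e' i')))
          (fun m => c' (m + Pi.single i' (-n))) x.1)).Finite := fun i i' =>
      (h4 i i').1.subset fun n hn => right_ne_zero_of_mul hn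
    rw [finsum_sum_comm _ _ fun i _ => ?_]
    · refine Finset.sum_congr rfl fun i _ => ?_
      rw [finsum_sum_comm _ _ fun i' _ => h5 i i']
      refine Finset.sum_congr rfl fun i' _ => ?_
      rw [← (h4 i i').2, ← smul_eq_mul (_ * _), smul_finsum]
      rfl
    · refine (Set.finite_iUnion fun i' => h5 i i').subset fun n hn => ?_
      obtain ⟨i', -, hi'⟩ := Finset.exists_ne_zero_of_sum_ne_zero hn
      exact Set.mem_iUnion.2 ⟨i', hi'⟩
  rw [h3]
  exact sum_mem fun i _ => sum_mem fun i' _ => functionals.smul_mem (homSeries_mem _ _ _) _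

end Hom

theorem coords_mul (x y : LMat) (i j : Fin 2) (m : ℤ) : coords (x * y) (i, j, m) =
    (x i 0 * y 0 j).coeff m + (x i 1 * y 1 j).coeff m := by
  simp only [coords, Matrix.mul_apply, Fin.sum_univ_two]
  rfl

/-- The maps `leftAct` and `rightAct`, i.e. the two kinds of translation. -/
structure IsTranslation (act : LMat → Lsl2 →ₗ[ℂ] LMat) : Prop where
  shiftE : ∃ w σ, IsShift w σ fun n x => act x (slE n)
  shiftH : ∃ w σ, IsShift w σ fun n x => act x (slH n)
  shiftF : ∃ w σ, IsShift w σ fun n x => act x (slF n)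

theorem isTranslation_leftAct : IsTranslation leftAct where
  shiftE := by
    refine ⟨fun i => if i.1 = 0 then 1 else 0, fun i => (1, i.2), fun n x ⟨a, b⟩ m => ?_⟩
    change coords ((slE n).1 * x) (a, b, m) = _
    rw [coords_mul]
    fin_cases a <;> simp [slE, slMk, coeff_mono_mul, coords]
  shiftH := by
    refine ⟨fun i => if i.1 = 0 then 1 else -1, id, fun n x ⟨a, b⟩ m => ?_⟩
    change coords ((slH n).1 * x) (a, b, m) = _
    rw [coords_mul]
    fin_cases a <;> simp [slH, slMk, coeff_mono_mul, coords, loop_neg_mul]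
  shiftF := by
    refine ⟨fun i => if i.1 = 1 then 1 else 0, fun i => (0, i.2), fun n x ⟨a, b⟩ m => ?_⟩
    change coords ((slF n).1 * x) (a, b, m) = _
    rw [coords_mul]
    fin_cases a <;> simp [slF, slMk, coeff_mono_mul, coords]

theorem isTranslation_rightAct : IsTranslation rightAct where
  shiftE := by
    refine ⟨fun i => if i.2 = 1 then 1 else 0, fun i => (i.1, 0), fun n x ⟨a, b⟩ m => ?_⟩
    change coords (x * (slE n).1) (a, b, m) = _
    rw [coords_mul]
    fin_cases b <;> simp [slE, slMk, coeff_mul_mono, coords]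
  shiftH := by
    refine ⟨fun i => if i.2 = 0 then 1 else -1, id, fun n x ⟨a, b⟩ m => ?_⟩
    change coords (x * (slH n).1) (a, b, m) = _
    rw [coords_mul]
    fin_cases b <;> simp [slH, slMk, coeff_mul_mono, coords, loop_mul_neg]
  shiftF := by
    refine ⟨fun i => if i.2 = 0 then 1 else 0, fun i => (i.1, 1), fun n x ⟨a, b⟩ m => ?_⟩
    change coords (x * (slF n).1) (a, b, m) = _
    rw [coords_mul]
    fin_cases b <;> simp [slF, slMk, coeff_mul_mono, coords]

theorem qShift_mono (q : ℂˣ) (n : ℤ) : qShift q (mono n) = (q : ℂ) ^ n • mono n := by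
  ext m
  rw [qShift_coeff, HahnSeries.coeff_smul, mono_coeff]
  split_ifs with h <;> simp [h]

theorem tauLie_slF (q : ℂˣ) (n : ℤ) : tauLie q (slF n) = (q : ℂ) ^ n • slF n := by
  apply Subtype.ext
  ext1 i j
  fin_cases i <;> fin_cases j <;> simp [tauLie, slF, slMk, qShift_mono]

theorem tauLie_slH (q : ℂˣ) (n : ℤ) : tauLie q (slH n) = (q : ℂ) ^ n • slH n := by
  apply Subtype.ext
  ext1 i j
  fin_cases i <;> fin_cases j <;> simp [tauLie, slH, slMk, qShift_mono]

section mem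
variable {ι ι' : Type} [Fintype ι] [Fintype ι']
  (M M' : ℤ) (e : ι → Fin 2 × Fin 2) (e' : ι' → Fin 2 × Fin 2) (c : (ι → ℤ) → ℂ)
  (c' : (ι' → ℤ) → ℂ) {act act' : LMat → Lsl2 →ₗ[ℂ] LMat}

theorem rTwist_mem (h : IsTranslation act) (h' : IsTranslation act') (q : ℂˣ) (φ : ℤ → ℂ) :
    (fun x : LSL2 => rTwist q φ ((homSeries_isRegular M e c).dirLin x.1 ∘ₗ act x.1)
      ((homSeries_isRegular M' e' c').dirLin x.1 ∘ₗ act' x.1)) ∈ functionals := by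
  classical
  obtain ⟨w₁, σ₁, h₁⟩ := h.shiftE
  obtain ⟨w₂, σ₂, h₂⟩ := h'.shiftF
  obtain ⟨w₃, σ₃, h₃⟩ := h.shiftH
  obtain ⟨w₄, σ₄, h₄⟩ := h'.shiftH
  have m₁ := finsum_shift_mem h₁ h₂ (fun n => (q : ℂ) ^ (-n)) M M' e e' c c'
  have m₂ := finsum_shift_mem h₃ h₄ (fun n => φ n * (q : ℂ) ^ (-n)) M M' e e' c c'
  convert add_mem m₁ (functionals.smul_mem m₂ (1 / 2 : ℂ)) using 1
  funext x
  simp only [rTwist, rPair, LinearMap.comp_apply, tauLie_slF, tauLie_slH, map_smul,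
    IsRegular.dirLin_apply, Pi.add_apply, Pi.smul_apply, smul_eq_mul]
  congr 2
  · funext n; ring
  · exact finsum_congr fun n => by ring

theorem rPair_mem (h : IsTranslation act) (h' : IsTranslation act') (φ : ℤ → ℂ) :
    (fun x : LSL2 => rPair φ ((homSeries_isRegular M e c).dirLin x.1 ∘ₗ act x.1)
      ((homSeries_isRegular M' e' c').dirLin x.1 ∘ₗ act' x.1)) ∈ functionals := by
  convert rTwist_mem M M' e e' c c' h h' 1 φ using 1
  funext x
  simp only [rTwist, rPair, LinearMap.comp_apply, tauLie_slF, tauLie_slH, Units.val_one, one_zpow,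
    one_smul]

end mem

theorem genBracket_mem (q : ℂˣ) (φ : ℤ → ℂ) (σ κ : ℂ) {f g : LSL2 → ℂ} (hf : f ∈ functionals)
    (hg : g ∈ functionals) : genBracket q φ σ κ f g ∈ functionals := by
  refine genBracket_mem_of_hom q φ σ κ (fun k k' M M' e e' c c' => ?_) hf hg
  have hl : ∀ {k : ℕ} (M : ℤ) (e : Fin k → Fin 2 × Fin 2) (c : (Fin k → ℤ) → ℂ) (x : LSL2),
      leftGrad (homFunctional M e c) x = (homSeries_isRegular M e c).dirLin x.1 ∘ₗ leftAct x.1 ∧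
      rightGrad (homFunctional M e c) x =
        (homSeries_isRegular M e c).dirLin x.1 ∘ₗ rightAct x.1 := by
    intro k M e c x
    rw [show homFunctional M e c = fun x => homSeries M e c x.1 from
      funext fun x => (homSeries_eq_homFunctional M e c x).symm]
    exact ⟨((homSeries_isRegular M e c).isLeftGradient x).leftGrad_eq,
      ((homSeries_isRegular M e c).isRightGradient x).rightGrad_eq⟩
  have hL := isTranslation_leftAct
  have hR := isTranslation_rightAct
  convert sub_mem (add_mem
      (functionals.smul_mem (sub_mem (rPair_mem M M' e e' c c' hL hL φ)
        (rPair_mem M' M e' e c' c hL hL φ)) (1 / 2 : ℂ))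
      (functionals.smul_mem (functionals.smul_mem (sub_mem (rPair_mem M M' e e' c c' hR hR φ)
        (rPair_mem M' M e' e c' c hR hR φ)) (1 / 2 : ℂ)) σ))
      (functionals.smul_mem (sub_mem (rTwist_mem M M' e e' c c' hR hL q φ)
        (rTwist_mem M' M e' e c' c hR hL q φ)) κ) using 1
  funext x
  simp only [genBracket, genPair, rWedge, (hl _ _ _ _).1, (hl _ _ _ _).2, Pi.add_apply,
    Pi.sub_apply, Pi.smul_apply, smul_eq_mul]
  ring

/-! ### Adjoint action, translations of curves -/

/-- The adjoint action `ξ ↦ gξg⁻¹` of the loop group on the loop algebra. -/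
def adLie (g : LSL2) : Lsl2 →ₗ[ℂ] Lsl2 where
  toFun ξ := ⟨g.1 * ξ.1 * (g⁻¹).1, by
    change Matrix.trace (g.1 * ξ.1 * (g⁻¹).1) = 0
    have h : (g⁻¹).1 * g.1 = 1 := congrArg Subtype.val (inv_mul_cancel g)
    rw [Matrix.trace_mul_comm, ← mul_assoc, h, one_mul]
    exact ξ.2⟩
  map_add' ξ ζ := Subtype.ext (by
    change g.1 * (ξ.1 + ζ.1) * (g⁻¹).1 = g.1 * ξ.1 * (g⁻¹).1 + g.1 * ζ.1 * (g⁻¹).1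
    rw [mul_add, add_mul])
  map_smul' c ξ := Subtype.ext (by
    change g.1 * (c • ξ.1) * (g⁻¹).1 = c • (g.1 * ξ.1 * (g⁻¹).1)
    rw [lmat_mul_smul, lmat_smul_mul])

theorem adLie_val (g : LSL2) (ξ : Lsl2) : (adLie g ξ).1 = g.1 * ξ.1 * (g⁻¹).1 := rfl

theorem adLie_mul (g h : LSL2) (ξ : Lsl2) : adLie (g * h) ξ = adLie g (adLie h ξ) := by
  apply Subtype.ext
  have : ((g * h)⁻¹).1 = (h⁻¹).1 * (g⁻¹).1 := congrArg Subtype.val (mul_inv_rev g h)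
  rw [adLie_val, adLie_val, adLie_val, this, show (g * h).1 = g.1 * h.1 from rfl]
  simp only [mul_assoc]

theorem tauLie_adLie (q : ℂˣ) (g : LSL2) (ξ : Lsl2) :
    tauLie q (adLie g ξ) = adLie (tauGroup q g) (tauLie q ξ) := by
  apply Subtype.ext
  have : (tauGroup q g)⁻¹ = tauGroup q g⁻¹ := (map_inv (tauGroup q) g).symm
  rw [adLie_val, this]
  change (g.1 * ξ.1 * (g⁻¹).1).map (qShift q) =
    g.1.map (qShift q) * ξ.1.map (qShift q) * (g⁻¹).1.map (qShift q)
  rw [Matrix.map_mul, Matrix.map_mul]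

theorem SAdicContinuous.comp_adLie {A : Lsl2 →ₗ[ℂ] ℂ} (hA : SAdicContinuous A) (g : LSL2) :
    SAdicContinuous (A ∘ₗ adLie g) := by
  obtain ⟨N, hN⟩ := hA
  obtain ⟨M, h1, h2⟩ := exists_lat₂ g.1 (g⁻¹).1
  exact ⟨N - M - M, fun ξ h => hN _ ((((h1.mul h).mul h2)).anti (by linarith))⟩

theorem trc_adLie_right (a : Lsl2) (g : LSL2) (ξ : Lsl2) :
    trc a.1 (adLie g ξ).1 = trc (adLie g⁻¹ a).1 ξ.1 := by
  rw [adLie_val, adLie_val, inv_inv, trc, trc]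
  congr 1
  rw [← mul_assoc, ← mul_assoc, Matrix.trace_mul_comm, ← mul_assoc, ← mul_assoc]

theorem trc_adLie (a b : Lsl2) (g : LSL2) : trc (adLie g a).1 (adLie g b).1 = trc a.1 b.1 := by
  rw [trc_adLie_right, ← adLie_mul, inv_mul_cancel]
  congr 1
  rw [adLie_val, inv_one]
  change (1 : LMat) * a.1 * 1 = a.1
  rw [one_mul, mul_one]

namespace PolyCurve

/-- The constant curve. -/
def const (g : LSL2) : PolyCurve := Matrix.SpecialLinearGroup.map Polynomial.C g

/-- The curve `τ(γ(t))`. -/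
def tau (q : ℂˣ) (γ : PolyCurve) : PolyCurve :=
  Matrix.SpecialLinearGroup.map (Polynomial.mapRingHom (qShift q)) γ

theorem eval_mul (γ δ : PolyCurve) (t : ℂ) : PolyCurve.eval (γ * δ) t = γ.eval t * δ.eval t :=
  map_mul _ _ _

theorem eval_inv (γ : PolyCurve) (t : ℂ) : PolyCurve.eval γ⁻¹ t = (γ.eval t)⁻¹ :=
  map_inv _ _

theorem eval_const (g : LSL2) (t : ℂ) : (const g).eval t = g := by
  apply Subtype.ext
  ext1 i j
  change Polynomial.eval _ (Polynomial.C (g.1 i j)) = _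
  rw [Polynomial.eval_C]

theorem qShift_C (q : ℂˣ) (t : ℂ) : qShift q (HahnSeries.C t) = HahnSeries.C t := by
  ext n
  rw [qShift_coeff]
  by_cases h : n = 0
  · simp [h]
  · simp [HahnSeries.coeff_single_of_ne h]

theorem eval_tau (q : ℂˣ) (γ : PolyCurve) (t : ℂ) :
    (tau q γ).eval t = tauGroup q (γ.eval t) := by
  apply Subtype.ext
  ext1 i j
  change Polynomial.eval _ (Polynomial.map (qShift q) (γ.1 i j)) =
    qShift q (Polynomial.eval _ (γ.1 i j))
  conv_lhs => rw [← qShift_C q t]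
  rw [Polynomial.eval_map_apply]

namespace IsTangent
variable {γ δ : PolyCurve} {ξ ζ : Lsl2}

theorem mul (hγ : γ.IsTangent ξ) (hδ : δ.IsTangent ζ) : (γ * δ).IsTangent (ξ + ζ) := by
  have hm : (γ * δ).1 = γ.1 * δ.1 := rfl
  have e : (ξ + ζ).1 = ξ.1 + ζ.1 := rfl
  intro i j
  rw [hm, e]
  constructor
  · rw [Matrix.mul_apply, Polynomial.finsetSum_coeff]
    simp only [Polynomial.mul_coeff_zero, (hγ _ _).1, (hδ _ _).1]
    rw [← Matrix.mul_apply, one_mul]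
  · rw [Matrix.mul_apply, Polynomial.finsetSum_coeff]
    simp only [Polynomial.mul_coeff_one, (hγ _ _).1, (hδ _ _).1, (hγ _ _).2, (hδ _ _).2]
    rw [Finset.sum_add_distrib, ← Matrix.mul_apply, ← Matrix.mul_apply, one_mul, mul_one, add_comm]
    rfl

theorem inv (hγ : γ.IsTangent ξ) : (γ⁻¹).IsTangent (-ξ) := by
  have h : ξ.1 1 1 = -ξ.1 0 0 := by
    rw [eq_neg_iff_add_eq_zero, add_comm]; exact trace_eq_zero_of_mem ξ
  have e : (γ⁻¹).1 = !![γ.1 1 1, -γ.1 0 1; -γ.1 1 0, γ.1 0 0] := by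
    rw [Matrix.SpecialLinearGroup.coe_inv, Matrix.adjugate_fin_two]
  intro i j
  rw [e, show (-ξ).1 = -ξ.1 from rfl]
  fin_cases i <;> fin_cases j <;> simp [(hγ _ _).1, (hγ _ _).2, h]

theorem conj (hγ : γ.IsTangent ξ) (g : LSL2) :
    (const g * γ * const g⁻¹).IsTangent (adLie g ξ) := by
  have hm : (const g * γ * const g⁻¹).1 = g.1.map Polynomial.C * γ.1 * (g⁻¹).1.map Polynomial.C :=
    rfl
  have h0 : ∀ k i j, ((const g * γ * const g⁻¹).1 i j).coeff k =
      (g.1 * (Matrix.of fun i j => (γ.1 i j).coeff k) * (g⁻¹).1) i j := by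
    intro k i j
    rw [hm]
    simp only [Matrix.mul_apply, Matrix.map_apply, Polynomial.finsetSum_coeff,
      Polynomial.coeff_mul_C, Polynomial.coeff_C_mul, Matrix.of_apply]
  intro i j
  rw [h0, h0, adLie_val]
  have h1 : (Matrix.of fun i j => (γ.1 i j).coeff 0) = (1 : LMat) := by
    ext1 i j; exact (hγ i j).1
  have h2 : (Matrix.of fun i j => (γ.1 i j).coeff 1) = ξ.1 := by
    ext1 i j; exact (hγ i j).2
  have h3 : g.1 * (g⁻¹).1 = 1 := congrArg Subtype.val (mul_inv_cancel g)
  rw [h1, h2, mul_one, h3]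
  exact ⟨rfl, rfl⟩

theorem tau (hγ : γ.IsTangent ξ) (q : ℂˣ) : (PolyCurve.tau q γ).IsTangent (tauLie q ξ) := by
  have h0 : ∀ k i j, ((PolyCurve.tau q γ).1 i j).coeff k = qShift q ((γ.1 i j).coeff k) :=
    fun k i j => Polynomial.coeff_map _ _
  intro i j
  rw [h0, h0, (hγ i j).1, (hγ i j).2]
  refine ⟨?_, rfl⟩
  rw [Matrix.one_apply]
  split_ifs <;> simp

end IsTangent
end PolyCurve

/-! ### Gradients of translated functionals -/

section translate
variable {f : LSL2 → ℂ} {x : LSL2} {A : Lsl2 →ₗ[ℂ] ℂ}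

/-- `∇'f(x) = ∇f(x) ∘ Ad x`. -/
theorem IsLeftGradient.isRightGradient (h : IsLeftGradient f x A) :
    IsRightGradient f x (A ∘ₗ adLie x) := by
  refine ⟨h.1.comp_adLie x, fun ξ γ hγ => ?_⟩
  have := h.2 _ _ (hγ.conj x)
  simpa [PolyCurve.eval_mul, PolyCurve.eval_const, mul_assoc] using this

theorem IsLeftGradient.rightGrad_eq (h : IsLeftGradient f x A) :
    rightGrad f x = A ∘ₗ adLie x := h.isRightGradient.rightGrad_eq

theorem isDifferentiable_of_left (h : ∀ x, ∃ A, IsLeftGradient f x A) : IsDifferentiable f :=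
  fun x => ⟨h x, let ⟨_, hA⟩ := h x; ⟨_, hA.isRightGradient⟩⟩

theorem isLeftGradient_mul_right (hf : IsDifferentiable f) (g x : LSL2) :
    IsLeftGradient (fun g => f (g * x)) g (leftGrad f (g * x)) :=
  ⟨(hf.left _).1, fun ξ γ hγ => by simpa [mul_assoc] using (hf.left (g * x)).2 ξ γ hγ⟩

theorem isLeftGradient_mul_left (hf : IsDifferentiable f) (g x : LSL2) :
    IsLeftGradient (fun x => f (g * x)) x (leftGrad f (g * x) ∘ₗ adLie g) :=
  ⟨(hf.left _).1.comp_adLie g, fun ξ γ hγ => by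
    have := (hf.left (g * x)).2 _ _ (hγ.conj g)
    simpa [PolyCurve.eval_mul, PolyCurve.eval_const, mul_assoc] using this⟩

theorem isLeftGradient_qGauge_left (hf : IsDifferentiable f) (q : ℂˣ) (g x : LSL2) :
    IsLeftGradient (fun g => f (qGauge q g x)) g
      (leftGrad f (qGauge q g x) ∘ₗ tauLie q - rightGrad f (qGauge q g x)) := by
  have h := hf.left (qGauge q g x)
  rw [h.rightGrad_eq, sub_eq_add_neg]
  refine ⟨(h.1.comp_tauLie q).add (h.1.comp_adLie _).neg, fun ξ γ hγ => ?_⟩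
  -- `τ(γ)Nγ⁻¹ = (τ(γ) · Nγ⁻¹N⁻¹)N` is a left translate of `N` along a polynomial curve.
  have := h.2 _ _ ((hγ.tau q).mul (hγ.inv.conj (qGauge q g x)))
  simp only [PolyCurve.eval_mul, PolyCurve.eval_const, PolyCurve.eval_tau, PolyCurve.eval_inv] at this
  refine (this.congr_deriv ?_).congr_of_eventuallyEq (.of_forall fun t => ?_)
  · have e : ∀ (B : Lsl2 →ₗ[ℂ] ℂ) (N : LSL2), B (adLie N (-ξ)) = -B (adLie N ξ) := fun B N =>
      (B ∘ₗ adLie N).map_neg ξ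
    rw [map_add, e]
    rfl
  · have e : ∀ y N : LSL2, tauGroup q y * (N * y⁻¹ * N⁻¹) * N = tauGroup q y * N * y⁻¹ :=
      fun y N => by simp only [mul_assoc, inv_mul_cancel, mul_one]
    beta_reduce
    rw [e]
    simp only [qGauge, map_mul, mul_inv_rev, mul_assoc]

theorem isLeftGradient_qGauge_right (hf : IsDifferentiable f) (q : ℂˣ) (g x : LSL2) :
    IsLeftGradient (fun x => f (qGauge q g x)) x
      (leftGrad f (qGauge q g x) ∘ₗ adLie (tauGroup q g)) :=
  ⟨(hf.left _).1.comp_adLie _, fun ξ γ hγ => by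
    have := (hf.left (qGauge q g x)).2 _ _ (hγ.conj (tauGroup q g))
    refine this.congr_of_eventuallyEq (.of_forall fun t => ?_)
    simp [PolyCurve.eval_mul, PolyCurve.eval_const, qGauge, mul_assoc]⟩

end translate

/-! ### The Poisson maps -/

section
variable {A B C : Lsl2 →ₗ[ℂ] ℂ}

theorem exists_dual_adLie {a : Lsl2} (ha : ∀ ξ : Lsl2, A ξ = trc a.1 ξ.1) (g : LSL2) (ξ : Lsl2) :
    (A ∘ₗ adLie g) ξ = trc (adLie g⁻¹ a).1 ξ.1 := by
  rw [LinearMap.comp_apply, ha, trc_adLie_right]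

/-- The symmetric part of `r` is invariant under the adjoint action. -/
theorem rPair_add_swap_adLie {φ : ℤ → ℂ} (hφ : ∀ n, φ n + φ (-n) = 1) (hA : SAdicContinuous A)
    (hB : SAdicContinuous B) (g : LSL2) :
    rPair φ (A ∘ₗ adLie g) (B ∘ₗ adLie g) + rPair φ (B ∘ₗ adLie g) (A ∘ₗ adLie g) =
      rPair φ A B + rPair φ B A := by
  obtain ⟨a, ha⟩ := exists_dual hA
  obtain ⟨b, hb⟩ := exists_dual hB
  rw [rPair_eq φ ha hb, rPair_eq φ hb ha, rPair_eq φ (exists_dual_adLie ha g)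
    (exists_dual_adLie hb g), rPair_eq φ (exists_dual_adLie hb g) (exists_dual_adLie ha g),
    trc_rOp_add hφ, trc_rOp_add hφ, trc_adLie]

theorem tauLie_slE (q : ℂˣ) (n : ℤ) : tauLie q (slE n) = (q : ℂ) ^ n • slE n := by
  apply Subtype.ext
  ext1 i j
  fin_cases i <;> fin_cases j <;> simp [tauLie, slE, slMk, qShift_mono]

/-- `(τ ⊗ τ)(r) = r`. -/
theorem rPair_comp_tauLie (φ : ℤ → ℂ) (q : ℂˣ) (A B : Lsl2 →ₗ[ℂ] ℂ) :
    rPair φ (A ∘ₗ tauLie q) (B ∘ₗ tauLie q) = rPair φ A B := by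
  have h : ∀ n : ℤ, (q : ℂ) ^ n * (q : ℂ) ^ (-n) = 1 := fun n => by
    rw [← zpow_add₀ q.ne_zero, add_neg_cancel, zpow_zero]
  simp only [rPair, LinearMap.comp_apply, tauLie_slF, tauLie_slH, tauLie_slE, map_smul,
    smul_eq_mul]
  congr 2
  · funext n
    linear_combination (A (slE n) * B (slF (-n))) * h n
  · exact finsum_congr fun n => by linear_combination (φ n * A (slH n) * B (slH (-n))) * h n

theorem rPair_sub_left (φ : ℤ → ℂ) (hA : SAdicContinuous A) (hB : SAdicContinuous B)
    (hC : SAdicContinuous C) : rPair φ (A - B) C = rPair φ A C - rPair φ B C := by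
  rw [sub_eq_add_neg, ← neg_one_smul ℂ B, rPair_add_left φ hA (hB.smul _) hC,
    rPair_smul_left φ _ hB hC]
  ring

theorem rPair_sub_right (φ : ℤ → ℂ) (hA : SAdicContinuous A) (hB : SAdicContinuous B)
    (hC : SAdicContinuous C) : rPair φ C (A - B) = rPair φ C A - rPair φ C B := by
  rw [sub_eq_add_neg, ← neg_one_smul ℂ B, rPair_add_right φ hA (hB.smul _) hC,
    rPair_smul_right φ _ hB hC]
  ring

theorem SAdicContinuous.sub (hA : SAdicContinuous A) (hB : SAdicContinuous B) :
    SAdicContinuous (A - B) := by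
  rw [sub_eq_add_neg]; exact hA.add hB.neg

end

theorem isPoissonMap_mul (φ : ℤ → ℂ) :
    IsPoissonMap (etaBracket φ) (etaBracket φ) (etaBracket φ) (fun g h => g * h) where
  differentiable_left f hf x := isDifferentiable_of_left fun g => ⟨_, isLeftGradient_mul_right hf g x⟩
  differentiable_right f hf g := isDifferentiable_of_left fun x => ⟨_, isLeftGradient_mul_left hf g x⟩
  bracket f h hf hh g x := by
    simp only [prodBracket, etaBracket]
    have e : ∀ f, IsDifferentiable f → rightGrad f (g * x) =
        (leftGrad f (g * x) ∘ₗ adLie g) ∘ₗ adLie x := fun f hf => by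
      rw [(hf.left _).rightGrad_eq]
      ext1 ξ
      simp [adLie_mul]
    rw [(isLeftGradient_mul_right hf g x).leftGrad_eq, (isLeftGradient_mul_right hh g x).leftGrad_eq,
      (isLeftGradient_mul_right hf g x).rightGrad_eq, (isLeftGradient_mul_right hh g x).rightGrad_eq,
      (isLeftGradient_mul_left hf g x).leftGrad_eq, (isLeftGradient_mul_left hh g x).leftGrad_eq,
      (isLeftGradient_mul_left hf g x).rightGrad_eq, (isLeftGradient_mul_left hh g x).rightGrad_eq,
      e f hf, e h hh]
    ring

theorem isPoissonMap_qGauge (q : ℂˣ) {φ : ℤ → ℂ} (hφ : ∀ n, φ n + φ (-n) = 1) :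
    IsPoissonMap (etaBracket φ) (etaStarBracket q φ) (etaStarBracket q φ) (qGauge q) where
  differentiable_left f hf x :=
    isDifferentiable_of_left fun g => ⟨_, isLeftGradient_qGauge_left hf q g x⟩
  differentiable_right f hf g :=
    isDifferentiable_of_left fun x => ⟨_, isLeftGradient_qGauge_right hf q g x⟩
  bracket f h hf hh g x := by
    simp only [prodBracket, etaBracket, etaStarBracket]
    have e : ∀ f, IsDifferentiable f → (leftGrad f (qGauge q g x) ∘ₗ adLie (tauGroup q g)) ∘ₗ
        adLie x = rightGrad f (qGauge q g x) ∘ₗ adLie g := fun f hf => by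
      rw [(hf.left _).rightGrad_eq]
      ext1 ξ
      simp only [LinearMap.comp_apply, ← adLie_mul]
      simp [qGauge]
    have e' : ∀ A : Lsl2 →ₗ[ℂ] ℂ, (A ∘ₗ adLie (tauGroup q g)) ∘ₗ tauLie q =
        (A ∘ₗ tauLie q) ∘ₗ adLie g := fun A => by
      ext1 ξ
      simp [tauLie_adLie]
    rw [(isLeftGradient_qGauge_left hf q g x).leftGrad_eq,
      (isLeftGradient_qGauge_left hh q g x).leftGrad_eq,
      (isLeftGradient_qGauge_left hf q g x).rightGrad_eq,
      (isLeftGradient_qGauge_left hh q g x).rightGrad_eq,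
      (isLeftGradient_qGauge_right hf q g x).leftGrad_eq,
      (isLeftGradient_qGauge_right hh q g x).leftGrad_eq,
      (isLeftGradient_qGauge_right hf q g x).rightGrad_eq,
      (isLeftGradient_qGauge_right hh q g x).rightGrad_eq, e f hf, e h hh]
    have cA := (hf.left (qGauge q g x)).1
    have cB := (hf.right (qGauge q g x)).1
    have cC := (hh.left (qGauge q g x)).1
    have cD := (hh.right (qGauge q g x)).1
    generalize leftGrad f (qGauge q g x) = A at *
    generalize rightGrad f (qGauge q g x) = B at *
    generalize leftGrad h (qGauge q g x) = C at *
    generalize rightGrad h (qGauge q g x) = D at *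
    simp only [rWedge, rTwist, LinearMap.sub_comp, e']
    rw [← rPair_comp_tauLie φ q (A ∘ₗ adLie (tauGroup q g)),
      ← rPair_comp_tauLie φ q (C ∘ₗ adLie (tauGroup q g)), ← rPair_comp_tauLie φ q A,
      ← rPair_comp_tauLie φ q C, e', e']
    replace cA := cA.comp_tauLie q
    replace cC := cC.comp_tauLie q
    generalize A ∘ₗ tauLie q = A at *
    generalize C ∘ₗ tauLie q = C at *
    have h1 := rPair_add_swap_adLie hφ cB cC g
    have h2 := rPair_add_swap_adLie hφ cD cA g
    rw [rPair_sub_left φ cA cB (cC.sub cD), rPair_sub_right φ cC cD cA,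
      rPair_sub_right φ cC cD cB, rPair_sub_left φ cC cD (cA.sub cB), rPair_sub_right φ cA cB cC,
      rPair_sub_right φ cA cB cD]
    replace cA := cA.comp_adLie g
    replace cB := cB.comp_adLie g
    replace cC := cC.comp_adLie g
    replace cD := cD.comp_adLie g
    rw [rPair_sub_left φ cA cB (cC.sub cD), rPair_sub_right φ cC cD cA,
      rPair_sub_right φ cC cD cB, rPair_sub_left φ cC cD (cA.sub cB), rPair_sub_right φ cA cB cC,
      rPair_sub_right φ cA cB cD]
    linear_combination (-1 / 2) * h1 + (1 / 2) * h2

/-! ### Admissibility of the unipotent subgroup -/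

theorem qGauge_one (q : ℂˣ) (M : LSL2) : qGauge q 1 M = M := by
  simp [qGauge]

theorem qGauge_mul (q : ℂˣ) (g h M : LSL2) :
    qGauge q (g * h) M = qGauge q g (qGauge q h M) := by
  simp [qGauge, mul_assoc]

/-- The polynomial curve `1 + t e E`, which runs in `LN`. -/
def unipotentCurve (e : Loop) : PolyCurve :=
  ⟨!![1, Polynomial.X * Polynomial.C e; 0, 1], by simp [Matrix.det_fin_two]⟩

theorem unipotentCurve_isTangent (e : Loop) : (unipotentCurve e).IsTangent (slMk e 0 0) := by
  intro i j
  fin_cases i <;> fin_cases j <;> simp [unipotentCurve, slMk, Polynomial.coeff_one]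

theorem unipotentCurve_eval_mem (e : Loop) (t : ℂ) : (unipotentCurve e).eval t ∈ LN := by
  have h : ∀ i j, ((unipotentCurve e).eval t).1 i j =
      ((unipotentCurve e).1 i j).eval (HahnSeries.C t : Loop) := fun _ _ => rfl
  refine ⟨?_, ?_, ?_⟩ <;> rw [h] <;> simp [unipotentCurve]

/-- The left gradient of an `LN`-invariant function vanishes on the Lie algebra of `LN`. -/
theorem IsLeftGradient.apply_upper {Φ : LSL2 → ℂ} {g : LSL2} {A : Lsl2 →ₗ[ℂ] ℂ}
    (hA : IsLeftGradient Φ g A) (hΦ : ∀ n ∈ LN, ∀ g, Φ (n * g) = Φ g) (e : Loop) :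
    A (slMk e 0 0) = 0 := by
  have h := hA.2 _ _ (unipotentCurve_isTangent e)
  simp only [hΦ _ (unipotentCurve_eval_mem e _)] at h
  exact h.unique (hasDerivAt_const _ _)

theorem adLie_slMk_of_mem {g : LSL2} (hg : g ∈ LN) (e h : Loop) :
    adLie g (slMk e h 0) = slMk e h 0 + slMk (-(h * g.1 0 1 + g.1 0 1 * h)) 0 0 := by
  obtain ⟨h1, h2, h3⟩ := hg
  apply Subtype.ext
  rw [adLie_val, Matrix.SpecialLinearGroup.coe_inv, Matrix.adjugate_fin_two]
  change _ = (slMk e h 0).1 + (slMk (-(h * g.1 0 1 + g.1 0 1 * h)) 0 0).1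
  rw [Matrix.eta_fin_two g.1, h1, h2, h3]
  ext1 i j
  fin_cases i <;> fin_cases j <;> simp [slMk, Matrix.mul_fin_two]
  ring

/-- On functionals that vanish on the upper triangular part, `r` only sees the diagonal part, on
which `LN` acts trivially modulo the upper triangular part. -/
theorem rPair_comp_adLie_of_mem {g : LSL2} (hg : g ∈ LN) (φ : ℤ → ℂ) {A C : Lsl2 →ₗ[ℂ] ℂ}
    (hA : ∀ e, A (slMk e 0 0) = 0) (hC : ∀ e, C (slMk e 0 0) = 0) :
    rPair φ (A ∘ₗ adLie g) (C ∘ₗ adLie g) = rPair φ A C := by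
  simp only [rPair, LinearMap.comp_apply, slE, slH, adLie_slMk_of_mem hg, map_add, hA, hC,
    add_zero, zero_mul]

theorem isAdmissible_LN (q : ℂˣ) {φ : ℤ → ℂ} (hφ : ∀ n, φ n + φ (-n) = 1) :
    IsAdmissible q (etaStarBracket q φ) LN := by
  rintro f ⟨hf, hf'⟩ h ⟨hh, hh'⟩
  refine ⟨etaStarBracket_eq q φ ▸ genBracket_mem q φ 1 1 hf hh, fun g hg x => ?_⟩
  have df := isDifferentiable_of_mem hf
  have dh := isDifferentiable_of_mem hh
  rw [← (isPoissonMap_qGauge q hφ).bracket f h df dh g x]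
  -- The factor `M_{2,q}` contributes `{f, h}(x)`, so the bracket along the group has to vanish.
  have inv : ∀ f : LSL2 → ℂ, (∀ g ∈ LN, ∀ x, f (qGauge q g x) = f x) →
      ∀ n ∈ LN, ∀ g, f (qGauge q (n * g) x) = f (qGauge q g x) := fun f hf n hn g => by
    rw [qGauge_mul, hf n hn]
  have h0 : etaBracket φ (fun g => f (qGauge q g x)) (fun g => h (qGauge q g x)) g = 0 := by
    have gf := isLeftGradient_qGauge_left df q g x
    have gh := isLeftGradient_qGauge_left dh q g x
    have vf := gf.apply_upper (inv f hf')
    have vh := gh.apply_upper (inv h hh')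
    rw [etaBracket, gf.rightGrad_eq, gh.rightGrad_eq, gf.leftGrad_eq, gh.leftGrad_eq, rWedge,
      rWedge, rPair_comp_adLie_of_mem hg φ vf vh, rPair_comp_adLie_of_mem hg φ vh vf, sub_self]
  rw [prodBracket, h0, zero_add]
  simp only [hf' g hg, hh' g hg]

/-! ### Differentiating the brackets -/

/-- The functionals `A t` vanish on a common lattice, and `A'` is their derivative at `0`. The common
lattice keeps the mode sums in `r` finite uniformly in `t`. -/
def HasLinDeriv (A : ℂ → Lsl2 →ₗ[ℂ] ℂ) (A' : Lsl2 →ₗ[ℂ] ℂ) : Prop :=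
  (∃ N, ∀ t ξ, Lat N ξ.1 → A t ξ = 0) ∧ ∀ ξ, HasDerivAt (fun t => A t ξ) (A' ξ) 0

theorem rPair_eq_sum (φ : ℤ → ℂ) {A B : Lsl2 →ₗ[ℂ] ℂ} {N : ℤ}
    (hA : ∀ ξ : Lsl2, Lat N ξ.1 → A ξ = 0) (hB : ∀ ξ : Lsl2, Lat N ξ.1 → B ξ = 0) :
    rPair φ A B = (∑ n ∈ Finset.Ioo (-N) N, A (slE n) * B (slF (-n))) +
      (1 / 2) * ∑ n ∈ Finset.Ioo (-N) N, φ n * (A (slH n) * B (slH (-n))) := by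
  have hz := VanishBelow.zero N
  have hm : ∀ n, N ≤ n → VanishBelow N (mono n) := fun n hn => (VanishBelow.mono_self n).anti hn
  rw [rPair, finsum_eq_sum_of_support_subset, finsum_eq_sum_of_support_subset]
  · intro n hn
    have h1 := left_ne_zero_of_mul (right_ne_zero_of_mul hn)
    have h2 := right_ne_zero_of_mul (right_ne_zero_of_mul hn)
    rw [Finset.coe_Ioo, Set.mem_Ioo]
    constructor
    · by_contra h
      exact h2 (hB _ (lat_slMk hz (hm _ (by omega)) hz))
    · by_contra h
      exact h1 (hA _ (lat_slMk hz (hm _ (by omega)) hz))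
  · intro n hn
    have h1 := left_ne_zero_of_mul hn
    have h2 := right_ne_zero_of_mul hn
    rw [Finset.coe_Ioo, Set.mem_Ioo]
    constructor
    · by_contra h
      exact h2 (hB _ (lat_slMk hz hz (hm _ (by omega))))
    · by_contra h
      exact h1 (hA _ (lat_slMk (hm _ (by omega)) hz hz))

theorem HasLinDeriv.vanish {A : ℂ → Lsl2 →ₗ[ℂ] ℂ} {A' : Lsl2 →ₗ[ℂ] ℂ} {N : ℤ}
    (hN : ∀ t ξ, Lat N ξ.1 → A t ξ = 0) (hd : ∀ ξ, HasDerivAt (fun t => A t ξ) (A' ξ) 0)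
    (ξ : Lsl2) (h : Lat N ξ.1) : A' ξ = 0 := by
  have h1 := hd ξ
  simp only [hN _ ξ h] at h1
  exact h1.unique (hasDerivAt_const _ _)

theorem HasLinDeriv.continuous {A : ℂ → Lsl2 →ₗ[ℂ] ℂ} {A' : Lsl2 →ₗ[ℂ] ℂ}
    (h : HasLinDeriv A A') : SAdicContinuous A' := by
  obtain ⟨⟨N, hN⟩, hd⟩ := h
  exact ⟨N, HasLinDeriv.vanish hN hd⟩

section HasLinDeriv
variable {A B C D : ℂ → Lsl2 →ₗ[ℂ] ℂ} {A' B' C' D' : Lsl2 →ₗ[ℂ] ℂ}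

theorem HasLinDeriv.rPair (φ : ℤ → ℂ) (hA : HasLinDeriv A A') (hB : HasLinDeriv B B') :
    HasDerivAt (fun t => rPair φ (A t) (B t)) (rPair φ A' (B 0) + rPair φ (A 0) B') 0 := by
  obtain ⟨⟨N, hN⟩, hd⟩ := hA
  obtain ⟨⟨M, hM⟩, hd'⟩ := hB
  have hN' : ∀ t (ξ : Lsl2), Lat (max N M) ξ.1 → A t ξ = 0 := fun t ξ h =>
    hN t ξ (h.anti (le_max_left _ _))
  have hM' : ∀ t (ξ : Lsl2), Lat (max N M) ξ.1 → B t ξ = 0 := fun t ξ h =>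
    hM t ξ (h.anti (le_max_right _ _))
  have vA := HasLinDeriv.vanish hN' hd
  have vB := HasLinDeriv.vanish hM' hd'
  simp only [rPair_eq_sum φ (hN' _) (hM' _), rPair_eq_sum φ vA (hM' _),
    rPair_eq_sum φ (hN' _) vB]
  refine ((HasDerivAt.fun_sum fun n _ => (hd (slE n)).mul (hd' (slF (-n)))).add
    ((HasDerivAt.fun_sum fun n _ => ((hd (slH n)).mul (hd' (slH (-n)))).const_mul
      (φ n)).const_mul (1 / 2))).congr_deriv ?_
  simp only [mul_add, Finset.sum_add_distrib]
  ring

theorem HasLinDeriv.comp_tauLie (hA : HasLinDeriv A A') (q : ℂˣ) :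
    HasLinDeriv (fun t => A t ∘ₗ tauLie q) (A' ∘ₗ tauLie q) := by
  obtain ⟨⟨N, hN⟩, hd⟩ := hA
  refine ⟨⟨N, fun t ξ h => hN t _ fun i j n hn => ?_⟩, fun ξ => hd _⟩
  change (q : ℂ) ^ n * _ = 0
  rw [h i j n hn, mul_zero]

theorem HasLinDeriv.genPair (q : ℂˣ) (φ : ℤ → ℂ) (σ κ : ℂ) (hA : HasLinDeriv A A')
    (hB : HasLinDeriv B B') (hC : HasLinDeriv C C') (hD : HasLinDeriv D D') :
    HasDerivAt (fun t => genPair q φ σ κ (A t) (B t) (C t) (D t))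
      (genPair q φ σ κ A' B' (C 0) (D 0) + genPair q φ σ κ (A 0) (B 0) C' D') 0 := by
  refine (((((hA.rPair φ hC).sub (hC.rPair φ hA)).div_const 2).add
    ((((hB.rPair φ hD).sub (hD.rPair φ hB)).div_const 2).const_mul σ)).sub
    (((hB.rPair φ (hC.comp_tauLie q)).sub (hD.rPair φ (hA.comp_tauLie q))).const_mul
      κ)).congr_deriv ?_
  simp only [QLoop.genPair, rWedge, rTwist]
  ring

end HasLinDeriv

namespace IsRegular
variable {F G : LMat → ℂ}

/-- The derivative of the left gradient in the direction `y`. -/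
def leftLin₂ (hF : IsRegular F) (x y : LMat) : Lsl2 →ₗ[ℂ] ℂ :=
  hF.dirLin₂ x y ∘ₗ leftAct x + hF.dirLin x ∘ₗ leftAct y

/-- The derivative of the right gradient in the direction `y`. -/
def rightLin₂ (hF : IsRegular F) (x y : LMat) : Lsl2 →ₗ[ℂ] ℂ :=
  hF.dirLin₂ x y ∘ₗ rightAct x + hF.dirLin x ∘ₗ rightAct y

theorem hasLinDeriv_left (hF : IsRegular F) {c : ℂ → LMat} {y : LMat} (hc : HasCoeffDeriv c y) :
    HasLinDeriv (fun t => hF.dirLin (c t) ∘ₗ leftAct (c t)) (hF.leftLin₂ (c 0) y) := by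
  refine ⟨?_, fun ξ => hF.hasDerivAt_dirDeriv hc (hc.mul_left ξ.1)⟩
  obtain ⟨⟨N, hN, -⟩, -⟩ := hc
  obtain ⟨K, hK⟩ := hF.exists_continuous N
  exact ⟨K - N, fun t ξ h => hK _ _ (hN t) (by simpa using h.mul (hN t))⟩

theorem hasLinDeriv_right (hF : IsRegular F) {c : ℂ → LMat} {y : LMat} (hc : HasCoeffDeriv c y) :
    HasLinDeriv (fun t => hF.dirLin (c t) ∘ₗ rightAct (c t)) (hF.rightLin₂ (c 0) y) := by
  refine ⟨?_, fun ξ => hF.hasDerivAt_dirDeriv hc (hc.mul_right ξ.1)⟩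
  obtain ⟨⟨N, hN, -⟩, -⟩ := hc
  obtain ⟨K, hK⟩ := hF.exists_continuous N
  exact ⟨K - N, fun t ξ h => hK _ _ (hN t) (by simpa using (hN t).mul h)⟩

/-- The left gradient of a regular function at a point of the loop group. -/
abbrev gradL (hF : IsRegular F) (x : LSL2) : Lsl2 →ₗ[ℂ] ℂ := hF.dirLin x.1 ∘ₗ leftAct x.1

/-- The right gradient of a regular function at a point of the loop group. -/
abbrev gradR (hF : IsRegular F) (x : LSL2) : Lsl2 →ₗ[ℂ] ℂ := hF.dirLin x.1 ∘ₗ rightAct x.1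

theorem genBracket_eq (q : ℂˣ) (φ : ℤ → ℂ) (σ κ : ℂ) (hF : IsRegular F) (hG : IsRegular G)
    (x : LSL2) : genBracket q φ σ κ (fun x => F x.1) (fun x => G x.1) x =
      genPair q φ σ κ (hF.gradL x) (hF.gradR x) (hG.gradL x) (hG.gradR x) := by
  rw [genBracket, (hF.isLeftGradient x).leftGrad_eq, (hG.isLeftGradient x).leftGrad_eq,
    (hF.isRightGradient x).rightGrad_eq, (hG.isRightGradient x).rightGrad_eq]

/-- The derivative of the bracket of two regular functions in the direction `y`. -/
def bracketDeriv (q : ℂˣ) (φ : ℤ → ℂ) (σ κ : ℂ) (hF : IsRegular F) (hG : IsRegular G) (x : LSL2)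
    (y : LMat) : ℂ :=
  genPair q φ σ κ (hF.leftLin₂ x.1 y) (hF.rightLin₂ x.1 y) (hG.gradL x) (hG.gradR x) +
    genPair q φ σ κ (hF.gradL x) (hF.gradR x) (hG.leftLin₂ x.1 y) (hG.rightLin₂ x.1 y)

theorem hasDerivAt_genBracket (q : ℂˣ) (φ : ℤ → ℂ) (σ κ : ℂ) (hF : IsRegular F)
    (hG : IsRegular G) {c : ℂ → LSL2} {y : LMat} (hc : HasCoeffDeriv (fun t => (c t).1) y) :
    HasDerivAt (fun t => genBracket q φ σ κ (fun x => F x.1) (fun x => G x.1) (c t))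
      (bracketDeriv q φ σ κ hF hG (c 0) y) 0 := by
  simp only [genBracket_eq q φ σ κ hF hG]
  exact (hF.hasLinDeriv_left hc).genPair q φ σ κ (hF.hasLinDeriv_right hc)
    (hG.hasLinDeriv_left hc) (hG.hasLinDeriv_right hc)

theorem leftGrad_genBracket (q : ℂˣ) (φ : ℤ → ℂ) (σ κ : ℂ) (hF : IsRegular F)
    (hG : IsRegular G)
    (hd : IsDifferentiable (genBracket q φ σ κ (fun x => F x.1) (fun x => G x.1)))
    (x : LSL2) (ξ : Lsl2) :
    leftGrad (genBracket q φ σ κ (fun x => F x.1) (fun x => G x.1)) x ξ =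
      bracketDeriv q φ σ κ hF hG x (ξ.1 * x.1) := by
  obtain ⟨γ, hγ⟩ := exists_isTangent ξ
  have h := hasDerivAt_genBracket q φ σ κ hF hG (hasCoeffDeriv_eval_mul hγ x)
  simp only [hγ.eval_zero, one_mul] at h
  exact ((hd.left x).2 ξ γ hγ).unique h

theorem rightGrad_genBracket (q : ℂˣ) (φ : ℤ → ℂ) (σ κ : ℂ) (hF : IsRegular F)
    (hG : IsRegular G)
    (hd : IsDifferentiable (genBracket q φ σ κ (fun x => F x.1) (fun x => G x.1)))
    (x : LSL2) (ξ : Lsl2) :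
    rightGrad (genBracket q φ σ κ (fun x => F x.1) (fun x => G x.1)) x ξ =
      bracketDeriv q φ σ κ hF hG x (x.1 * ξ.1) := by
  obtain ⟨γ, hγ⟩ := exists_isTangent ξ
  have h := hasDerivAt_genBracket q φ σ κ hF hG (hasCoeffDeriv_mul_eval hγ x)
  simp only [hγ.eval_zero, mul_one] at h
  exact ((hd.right x).2 ξ γ hγ).unique h

end IsRegular

/-! ### Hamiltonian vectors -/

-- Restatements for the instances found on `Lsl2`.
theorem lsl2_map_sub (A : Lsl2 →ₗ[ℂ] ℂ) (ξ ζ : Lsl2) : A (ξ - ζ) = A ξ - A ζ := A.map_sub ξ ζ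
theorem tauLie_sub (q : ℂˣ) (ξ ζ : Lsl2) : tauLie q (ξ - ζ) = tauLie q ξ - tauLie q ζ :=
  Subtype.ext (by ext1 i j; exact map_sub (qShift q) (ξ.1 i j) (ζ.1 i j))

/-- `rOp` on traceless matrices. -/
def rLie (φ : ℤ → ℂ) (a : Lsl2) : Lsl2 := slMk (a.1 0 1) (mulCoeff φ (a.1 0 0)) 0

theorem rLie_val (φ : ℤ → ℂ) (a : Lsl2) : (rLie φ a).1 = rOp φ a.1 := rfl

/-- The left component of the Hamiltonian vector of a function whose gradients are represented
by `c` and `d`. -/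
def hamL (q : ℂˣ) (φ : ℤ → ℂ) (κ : ℂ) (c d : Lsl2) : Lsl2 :=
  (rLie φ c - (1 / 2 : ℂ) • c) + κ • tauLie q (d - rLie φ d)

/-- The right component of the Hamiltonian vector of a function whose gradients are represented
by `c` and `d`. -/
def hamR (q : ℂˣ) (φ : ℤ → ℂ) (σ κ : ℂ) (c d : Lsl2) : Lsl2 :=
  σ • (rLie φ d - (1 / 2 : ℂ) • d) - κ • rLie φ (tauLie q⁻¹ c)

theorem trc_tauLie (q : ℂˣ) (a ξ : Lsl2) : trc a.1 (tauLie q ξ).1 = trc (tauLie q⁻¹ a).1 ξ.1 := by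
  have h : ∀ a b : Loop, (a * qShift q b).coeff 0 = (qShift q⁻¹ a * b).coeff 0 := fun a b => by
    rw [← finsum_coeff_mul_coeff, ← finsum_coeff_mul_coeff]
    refine finsum_congr fun n => ?_
    simp only [qShift_coeff, Units.val_inv_eq_inv_val, inv_zpow, zpow_neg, inv_inv]
    ring
  rw [trc_eq, trc_eq]
  change (_ * qShift q _).coeff 0 + (_ * qShift q _).coeff 0 +
    ((_ * qShift q _).coeff 0 + (_ * qShift q _).coeff 0) =
    (qShift q⁻¹ _ * _).coeff 0 + (qShift q⁻¹ _ * _).coeff 0 +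
    ((qShift q⁻¹ _ * _).coeff 0 + (qShift q⁻¹ _ * _).coeff 0)
  simp only [h]

/-- The bracket is the derivative along the Hamiltonian vector. -/
theorem genPair_eq (q : ℂˣ) {φ : ℤ → ℂ} (hφ : ∀ n, φ n + φ (-n) = 1) (σ κ : ℂ)
    {A B C D : Lsl2 →ₗ[ℂ] ℂ} (hA : SAdicContinuous A) (hB : SAdicContinuous B) {c d : Lsl2}
    (hc : ∀ ξ : Lsl2, C ξ = trc c.1 ξ.1) (hd : ∀ ξ : Lsl2, D ξ = trc d.1 ξ.1) :
    genPair q φ σ κ A B C D = A (hamL q φ κ c d) + B (hamR q φ σ κ c d) := by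
  obtain ⟨a, ha⟩ := exists_dual hA
  obtain ⟨b, hb⟩ := exists_dual hB
  have hcτ : ∀ ξ : Lsl2, (C ∘ₗ tauLie q) ξ = trc (tauLie q⁻¹ c).1 ξ.1 := fun ξ => by
    rw [LinearMap.comp_apply, hc, trc_tauLie]
  have haτ : ∀ ξ : Lsl2, (A ∘ₗ tauLie q) ξ = trc (tauLie q⁻¹ a).1 ξ.1 := fun ξ => by
    rw [LinearMap.comp_apply, ha, trc_tauLie]
  have s1 := trc_rOp_add hφ a c
  have s2 := trc_rOp_add hφ b d
  have s3 := trc_rOp_add hφ (tauLie q⁻¹ a) d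
  have e1 : trc (tauLie q⁻¹ a).1 d.1 = A (tauLie q d) := by rw [← haτ]; rfl
  have e2 : trc (tauLie q⁻¹ a).1 (rOp φ d.1) = A (tauLie q (rLie φ d)) := by
    rw [← rLie_val, ← haτ]; rfl
  rw [e1, e2] at s3
  simp only [genPair, rWedge, rTwist]
  rw [rPair_eq φ ha hc, rPair_eq φ hc ha, rPair_eq φ hb hd, rPair_eq φ hd hb, rPair_eq φ hb hcτ,
    rPair_eq φ hd haτ]
  simp only [hamL, hamR, map_add, tauLie_sub, lsl2_map_sub, map_smul, smul_eq_mul]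
  have e3 : A (rLie φ c) = trc a.1 (rOp φ c.1) := ha _
  have e4 : A c = trc a.1 c.1 := ha _
  have e5 : B (rLie φ d) = trc b.1 (rOp φ d.1) := hb _
  have e6 : B d = trc b.1 d.1 := hb _
  have e7 : B (rLie φ (tauLie q⁻¹ c)) = trc b.1 (rOp φ (tauLie q⁻¹ c).1) := hb _
  rw [e3, e4, e5, e6, e7]
  linear_combination (-1 / 2) * s1 - σ / 2 * s2 + κ * s3

/-! ### The modified classical Yang–Baxter identity -/

/-- `tr(x[y, z])` in terms of the entries `x = (p, q; r, -p)` and so on. -/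
def tripleTr {K : Type*} [CommRing K] (p q r p' q' r' p'' q'' r'' : K) : K :=
  2 * (p * (q' * r'' - q'' * r') + q * (r' * p'' - r'' * p') + r * (p' * q'' - p'' * q'))

/-- The pairing `⟨x, [y, z]⟩`. -/
def brTrc (x y z : Lsl2) : ℂ := trc x.1 (y.1 * z.1 - z.1 * y.1)

theorem brTrc_eq (x y z : Lsl2) : brTrc x y z = (tripleTr (x.1 0 0) (x.1 0 1) (x.1 1 0)
    (y.1 0 0) (y.1 0 1) (y.1 1 0) (z.1 0 0) (z.1 0 1) (z.1 1 0)).coeff 0 := by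
  have h : ∀ a : Lsl2, a.1 = !![a.1 0 0, a.1 0 1; a.1 1 0, -a.1 0 0] := fun a =>
    congrArg Subtype.val (slMk_entries a).symm
  rw [brTrc, trc, h x, h y, h z]
  congr 1
  rw [Matrix.trace_fin_two]
  simp [Matrix.mul_apply, Fin.sum_univ_two, tripleTr]
  ring

theorem tripleTr_half {K : Type*} [CommRing K] (p q r p' q' r' p'' q'' r'' : K) :
    tripleTr p q r (2 * p') (2 * q') (2 * r') (2 * p'') (2 * q'') (2 * r'') =
      4 * tripleTr p q r p' q' r' p'' q'' r'' := by
  simp only [tripleTr]; ring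

theorem loop_four_mul_coeff (a : Loop) (n : ℤ) : (4 * a).coeff n = 4 * a.coeff n := by
  have : (4 : Loop) * a = (4 : ℂ) • a := by
    rw [← HahnSeries.C_mul_eq_smul, map_ofNat]
  rw [this, HahnSeries.coeff_smul, smul_eq_mul]

/-- The pairing `4⟨x, [y, z]⟩` in terms of the doubled entries of `y` and `z`; this clears the
denominators of Hamiltonian vectors. -/
theorem four_brTrc (x y z : Lsl2) : 4 * brTrc x y z = (tripleTr (x.1 0 0) (x.1 0 1) (x.1 1 0)
    (2 * y.1 0 0) (2 * y.1 0 1) (2 * y.1 1 0) (2 * z.1 0 0) (2 * z.1 0 1)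
    (2 * z.1 1 0)).coeff 0 := by
  rw [tripleTr_half, loop_four_mul_coeff, brTrc_eq]

theorem loop_two_mul_half (a : Loop) : (2 : Loop) * ((1 / 2 : ℂ) • a) = a := by
  have : (2 : Loop) * ((1 / 2 : ℂ) • a) = (2 : ℂ) • ((1 / 2 : ℂ) • a) := by
    rw [← map_ofNat (HahnSeries.C : ℂ →+* Loop) 2, HahnSeries.C_mul_eq_smul]
  rw [this, smul_smul]
  norm_num

theorem two_mul_entries_sub_half (x y : Lsl2) (i j : Fin 2) :
    (2 : Loop) * (x - (1 / 2 : ℂ) • y).1 i j = 2 * x.1 i j - y.1 i j := by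
  change (2 : Loop) * (x.1 i j - (1 / 2 : ℂ) • y.1 i j) = _
  rw [mul_sub, loop_two_mul_half]

/-- The identity behind the Jacobi identity for `η`: the operator `ρ = P - 1/2` satisfies the
modified classical Yang–Baxter equation. -/
theorem brTrc_rho (φ : ℤ → ℂ) (a₁ a₂ a₃ : Lsl2) :
    brTrc a₁ (rLie φ a₂ - (1 / 2 : ℂ) • a₂) (rLie φ a₃ - (1 / 2 : ℂ) • a₃) +
    brTrc a₂ (rLie φ a₃ - (1 / 2 : ℂ) • a₃) (rLie φ a₁ - (1 / 2 : ℂ) • a₁) +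
    brTrc a₃ (rLie φ a₁ - (1 / 2 : ℂ) • a₁) (rLie φ a₂ - (1 / 2 : ℂ) • a₂) =
      -(1 / 4) * brTrc a₁ a₂ a₃ := by
  have h : ∀ a : Lsl2, (rLie φ a).1 0 0 = mulCoeff φ (a.1 0 0) ∧ (rLie φ a).1 0 1 = a.1 0 1 ∧
    (rLie φ a).1 1 0 = 0 := fun a => ⟨rfl, rfl, rfl⟩
  have key : 4 * (brTrc a₁ (rLie φ a₂ - (1 / 2 : ℂ) • a₂) (rLie φ a₃ - (1 / 2 : ℂ) • a₃)) +
    4 * (brTrc a₂ (rLie φ a₃ - (1 / 2 : ℂ) • a₃) (rLie φ a₁ - (1 / 2 : ℂ) • a₁)) +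
    4 * (brTrc a₃ (rLie φ a₁ - (1 / 2 : ℂ) • a₁) (rLie φ a₂ - (1 / 2 : ℂ) • a₂)) +
      brTrc a₁ a₂ a₃ = 0 := by
    rw [four_brTrc, four_brTrc, four_brTrc, brTrc_eq, ← HahnSeries.coeff_add,
      ← HahnSeries.coeff_add, ← HahnSeries.coeff_add]
    simp only [two_mul_entries_sub_half, (h _).1, (h _).2.1, (h _).2.2]
    refine (congrArg (fun z : Loop => z.coeff 0) (?_ : _ = (0 : Loop))).trans rfl
    simp only [tripleTr]
    ring
  linear_combination (1 / 4) * key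

/-- The left Hamiltonian component for `η_*^q`, untwisted by `τ`. -/
def starL (φ : ℤ → ℂ) (a b : Lsl2) : Lsl2 := rLie φ a + (b - rLie φ b) - (1 / 2 : ℂ) • a

/-- The right Hamiltonian component for `η_*^q`. -/
def starR (φ : ℤ → ℂ) (a b : Lsl2) : Lsl2 := rLie φ b - rLie φ a - (1 / 2 : ℂ) • b

/-- The identity behind the Jacobi identity for `η_*^q`. -/
theorem brTrc_star (φ : ℤ → ℂ) (a₁ a₂ a₃ b₁ b₂ b₃ : Lsl2) :
    brTrc a₁ (starL φ a₂ b₂) (starL φ a₃ b₃) - brTrc b₁ (starR φ a₂ b₂) (starR φ a₃ b₃) +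
    (brTrc a₂ (starL φ a₃ b₃) (starL φ a₁ b₁) - brTrc b₂ (starR φ a₃ b₃) (starR φ a₁ b₁)) +
    (brTrc a₃ (starL φ a₁ b₁) (starL φ a₂ b₂) - brTrc b₃ (starR φ a₁ b₁) (starR φ a₂ b₂)) =
      -(1 / 4) * (brTrc a₁ a₂ a₃ - brTrc b₁ b₂ b₃) := by
  have h : ∀ a : Lsl2, (rLie φ a).1 0 0 = mulCoeff φ (a.1 0 0) ∧ (rLie φ a).1 0 1 = a.1 0 1 ∧
    (rLie φ a).1 1 0 = 0 := fun a => ⟨rfl, rfl, rfl⟩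
  have hadd : ∀ (a b : Lsl2) i j, (a + b).1 i j = a.1 i j + b.1 i j := fun _ _ _ _ => rfl
  have hsub : ∀ (a b : Lsl2) i j, (a - b).1 i j = a.1 i j - b.1 i j := fun _ _ _ _ => rfl
  have key :
      4 * brTrc a₁ (starL φ a₂ b₂) (starL φ a₃ b₃) + 4 * brTrc a₂ (starL φ a₃ b₃) (starL φ a₁ b₁) +
      4 * brTrc a₃ (starL φ a₁ b₁) (starL φ a₂ b₂) + brTrc a₁ a₂ a₃ =
      4 * brTrc b₁ (starR φ a₂ b₂) (starR φ a₃ b₃) + 4 * brTrc b₂ (starR φ a₃ b₃) (starR φ a₁ b₁) +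
      4 * brTrc b₃ (starR φ a₁ b₁) (starR φ a₂ b₂) + brTrc b₁ b₂ b₃ := by
    simp only [four_brTrc]
    simp only [brTrc_eq, ← HahnSeries.coeff_add]
    refine congrArg (fun z : Loop => z.coeff 0) ?_
    simp only [starL, starR, two_mul_entries_sub_half]
    simp only [hadd, hsub, (h _).1, (h _).2.1, (h _).2.2]
    simp only [tripleTr]
    ring
  linear_combination (1 / 4) * key

/-! ### The Jacobi identity -/

/-- The velocity at `x` of the vector `(u, v)`. -/
def vel (x : LMat) (u v : Lsl2) : LMat := u.1 * x + x * v.1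

namespace IsRegular
variable {F G H : LMat → ℂ}

/-- The second derivative of `F` along the vector `(u, v)` and then in the direction `y`. -/
def second (_hF : IsRegular F) (x y : LMat) (u v : Lsl2) : ℂ :=
  dirDeriv₂ F x y (vel x u v) + dirDeriv F x (vel y u v)

theorem left_add_right (hF : IsRegular F) (x y : LMat) (u v : Lsl2) :
    hF.leftLin₂ x y u + hF.rightLin₂ x y v = hF.second x y u v := by
  rw [second, vel, vel, hF.dirDeriv₂_add, hF.dirDeriv_add]
  simp only [leftLin₂, rightLin₂, LinearMap.add_apply, LinearMap.comp_apply, leftAct_apply,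
    rightAct_apply, dirLin_apply, dirLin₂_apply]
  ring

/-- Linearity in `y`, which uses the symmetry of the second derivative. -/
theorem second_add (hF : IsRegular F) (x y z : LMat) (u v : Lsl2) :
    hF.second x (y + z) u v = hF.second x y u v + hF.second x z u v := by
  have e : vel (y + z) u v = vel y u v + vel z u v := by
    simp only [vel, mul_add, add_mul]; abel
  rw [second, second, second, e, hF.dirDeriv_add, hF.dirDeriv₂_comm, hF.dirDeriv₂_add,
    hF.dirDeriv₂_comm x _ y, hF.dirDeriv₂_comm x _ z]
  ring

/-- The commutator of two derivatives along left and right translations. -/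
theorem second_sub (hF : IsRegular F) (x : LMat) (u v u' v' : Lsl2) :
    hF.second x (vel x u v) u' v' - hF.second x (vel x u' v') u v =
      dirDeriv F x ((u'.1 * u.1 - u.1 * u'.1) * x) +
        dirDeriv F x (x * (v.1 * v'.1 - v'.1 * v.1)) := by
  have e : vel (vel x u v) u' v' = ((u'.1 * u.1 - u.1 * u'.1) * x +
      x * (v.1 * v'.1 - v'.1 * v.1)) + vel (vel x u' v') u v := by
    simp only [vel, mul_add, add_mul, mul_sub, sub_mul, mul_assoc]; abel
  rw [second, second, e, hF.dirDeriv_add, hF.dirDeriv_add, hF.dirDeriv₂_comm]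
  ring

end IsRegular

/-- The commutator of traceless matrices. -/
def lsl2Br (x y : Lsl2) : Lsl2 := ⟨x.1 * y.1 - y.1 * x.1, by
  change Matrix.trace (x.1 * y.1 - y.1 * x.1) = 0
  rw [Matrix.trace_sub, Matrix.trace_mul_comm, sub_self]⟩

section jacobi
variable {q : ℂˣ} {φ : ℤ → ℂ} {σ κ : ℂ}

theorem brTrc_adLie (g : LSL2) (x y z : Lsl2) :
    brTrc (adLie g x) (adLie g y) (adLie g z) = brTrc x y z := by
  have h : (g⁻¹).1 * g.1 = 1 := congrArg Subtype.val (inv_mul_cancel g)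
  have e : ∀ y z : Lsl2, (adLie g y).1 * (adLie g z).1 = g.1 * (y.1 * z.1) * (g⁻¹).1 := by
    intro y z
    rw [adLie_val, adLie_val]
    calc g.1 * y.1 * (g⁻¹).1 * (g.1 * z.1 * (g⁻¹).1)
        = g.1 * y.1 * ((g⁻¹).1 * g.1) * z.1 * (g⁻¹).1 := by simp only [mul_assoc]
      _ = _ := by rw [h, mul_one]; simp only [mul_assoc]
  have e2 : (adLie g y).1 * (adLie g z).1 - (adLie g z).1 * (adLie g y).1 =
      (adLie g (lsl2Br y z)).1 := by
    rw [e, e, adLie_val, lsl2Br, mul_sub, sub_mul]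
  rw [brTrc, e2, trc_adLie]
  rfl

theorem brTrc_tauLie (q : ℂˣ) (x y z : Lsl2) :
    brTrc x (tauLie q y) (tauLie q z) = brTrc (tauLie q⁻¹ x) y z := by
  have e : (tauLie q y).1 * (tauLie q z).1 - (tauLie q z).1 * (tauLie q y).1 =
      (tauLie q (lsl2Br y z)).1 := by
    change y.1.map (qShift q) * z.1.map (qShift q) - z.1.map (qShift q) * y.1.map (qShift q) =
      (y.1 * z.1 - z.1 * y.1).map (qShift q)
    rw [← Matrix.map_mul, ← Matrix.map_mul]
    ext1 i j
    exact (map_sub (qShift q) _ _).symm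
  rw [brTrc, e, trc_tauLie]
  rfl

theorem tauLie_inv_apply (q : ℂˣ) (x : Lsl2) : tauLie q (tauLie q⁻¹ x) = x := by
  apply Subtype.ext
  ext i j n
  change (q : ℂ) ^ n * (((q⁻¹ : ℂˣ) : ℂ) ^ n * _) = _
  rw [← mul_assoc, ← mul_zpow, Units.mul_inv, one_zpow, one_mul]

theorem brTrc_neg_neg (x y z : Lsl2) : brTrc x (-y) (-z) = brTrc x y z := by
  rw [brTrc_eq, brTrc_eq]
  refine congrArg (fun a : Loop => a.coeff 0) ?_
  change tripleTr _ _ _ (-y.1 0 0) (-y.1 0 1) (-y.1 1 0) (-z.1 0 0) (-z.1 0 1) (-z.1 1 0) = _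
  simp only [tripleTr]
  ring

theorem rLie_tauLie (q : ℂˣ) (φ : ℤ → ℂ) (a : Lsl2) :
    rLie φ (tauLie q a) = tauLie q (rLie φ a) := by
  apply Subtype.ext
  ext i j n
  fin_cases i <;> fin_cases j <;> simp [rLie, slMk, tauLie, qShift_coeff, mul_left_comm]

/-- The algebraic form of the Jacobi identity, for both brackets. -/
theorem sum_brTrc_ham (h : σ = -1 ∧ κ = 0 ∨ σ = 1 ∧ κ = 1) (q : ℂˣ) (φ : ℤ → ℂ)
    (a₁ a₂ a₃ b₁ b₂ b₃ : Lsl2) (hab : brTrc a₁ a₂ a₃ = brTrc b₁ b₂ b₃) :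
    brTrc a₁ (hamL q φ κ a₂ b₂) (hamL q φ κ a₃ b₃) -
      brTrc b₁ (hamR q φ σ κ a₂ b₂) (hamR q φ σ κ a₃ b₃) +
    (brTrc a₂ (hamL q φ κ a₃ b₃) (hamL q φ κ a₁ b₁) -
      brTrc b₂ (hamR q φ σ κ a₃ b₃) (hamR q φ σ κ a₁ b₁)) +
    (brTrc a₃ (hamL q φ κ a₁ b₁) (hamL q φ κ a₂ b₂) -
      brTrc b₃ (hamR q φ σ κ a₁ b₁) (hamR q φ σ κ a₂ b₂)) = 0 := by
  rcases h with ⟨rfl, rfl⟩ | ⟨rfl, rfl⟩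
  · have e1 : ∀ a b, hamL q φ 0 a b = rLie φ a - (1 / 2 : ℂ) • a := fun a b => by
      rw [hamL, zero_smul, add_zero]
    have e2 : ∀ a b, hamR q φ (-1) 0 a b = -(rLie φ b - (1 / 2 : ℂ) • b) := fun a b => by
      rw [hamR, zero_smul]
      have h : ∀ ξ : Lsl2, (-1 : ℂ) • ξ - 0 = -ξ := fun ξ =>
        (sub_zero ((-1 : ℂ) • ξ)).trans (neg_one_smul ℂ ξ)
      exact h _
    simp only [e1, e2, brTrc_neg_neg]
    linear_combination brTrc_rho φ a₁ a₂ a₃ - brTrc_rho φ b₁ b₂ b₃ - (1 / 4) * hab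
  · have e1 : ∀ a b, hamL q φ 1 a b = tauLie q (starL φ (tauLie q⁻¹ a) b) := fun a b => by
      simp only [hamL, starL, tauLie_sub, map_add, ← rLie_tauLie, map_smul, tauLie_inv_apply,
        one_smul]
      abel
    have e2 : ∀ a b, hamR q φ 1 1 a b = starR φ (tauLie q⁻¹ a) b := fun a b => by
      rw [hamR, starR, one_smul, one_smul]
      abel
    have e3 : brTrc (tauLie q⁻¹ a₁) (tauLie q⁻¹ a₂) (tauLie q⁻¹ a₃) = brTrc a₁ a₂ a₃ := by
      rw [← brTrc_tauLie, tauLie_inv_apply, tauLie_inv_apply]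
    simp only [e1, e2, brTrc_tauLie]
    rw [brTrc_star, e3, hab, sub_self, mul_zero]

theorem brTrc_swap (x y z : Lsl2) : brTrc x y z = -brTrc x z y := by
  rw [brTrc_eq, brTrc_eq, ← HahnSeries.coeff_neg]
  refine congrArg (fun a : Loop => a.coeff 0) ?_
  simp only [tripleTr]
  ring

/-- The Jacobiator is the cyclic sum of commutators of Hamiltonian vectors, as the second
derivatives cancel in pairs; this sum vanishes by `sum_brTrc_ham`. -/
theorem genBracket_jacobi (h : σ = -1 ∧ κ = 0 ∨ σ = 1 ∧ κ = 1) (q : ℂˣ) {φ : ℤ → ℂ}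
    (hφ : ∀ n, φ n + φ (-n) = 1) {f₁ f₂ f₃ : LSL2 → ℂ} (h₁ : f₁ ∈ functionals)
    (h₂ : f₂ ∈ functionals) (h₃ : f₃ ∈ functionals) :
    genBracket q φ σ κ f₁ (genBracket q φ σ κ f₂ f₃) +
      genBracket q φ σ κ f₂ (genBracket q φ σ κ f₃ f₁) +
      genBracket q φ σ κ f₃ (genBracket q φ σ κ f₁ f₂) = 0 := by
  have d₁₂ := isDifferentiable_of_mem (genBracket_mem q φ σ κ h₁ h₂)
  have d₂₃ := isDifferentiable_of_mem (genBracket_mem q φ σ κ h₂ h₃)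
  have d₃₁ := isDifferentiable_of_mem (genBracket_mem q φ σ κ h₃ h₁)
  obtain ⟨F₁, hF₁, e₁⟩ := exists_isRegular h₁
  obtain ⟨F₂, hF₂, e₂⟩ := exists_isRegular h₂
  obtain ⟨F₃, hF₃, e₃⟩ := exists_isRegular h₃
  obtain rfl : f₁ = fun x : LSL2 => F₁ x.1 := funext e₁
  obtain rfl : f₂ = fun x : LSL2 => F₂ x.1 := funext e₂
  obtain rfl : f₃ = fun x : LSL2 => F₃ x.1 := funext e₃
  funext x
  have dual : ∀ {F : LMat → ℂ} (hF : IsRegular F), ∃ a b : Lsl2,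
      (∀ ξ : Lsl2, hF.gradL x ξ = trc a.1 ξ.1) ∧ (∀ ξ : Lsl2, hF.gradR x ξ = trc b.1 ξ.1) ∧
      b = adLie x⁻¹ a := by
    intro F hF
    obtain ⟨a, ha⟩ := exists_dual (hF.dirLin_continuous x.1 (leftAct_continuous x.1))
    refine ⟨a, adLie x⁻¹ a, ha, fun ξ => ?_, rfl⟩
    rw [← exists_dual_adLie ha]
    exact LinearMap.congr_fun ((hF.isRightGradient x).unique (hF.isLeftGradient x).isRightGradient) ξ
  obtain ⟨a₁, b₁, ha₁, hb₁, hab₁⟩ := dual hF₁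
  obtain ⟨a₂, b₂, ha₂, hb₂, hab₂⟩ := dual hF₂
  obtain ⟨a₃, b₃, ha₃, hb₃, hab₃⟩ := dual hF₃
  -- The bracket with a bracket is a second derivative along Hamiltonian vectors.
  have nested : ∀ {F G H : LMat → ℂ} (hF : IsRegular F) (hG : IsRegular G) (hH : IsRegular H)
      (_ : IsDifferentiable (genBracket q φ σ κ (fun x => G x.1) (fun x => H x.1)))
      (a b c d c' d' : Lsl2) (_ : ∀ ξ : Lsl2, hF.gradL x ξ = trc a.1 ξ.1)
      (_ : ∀ ξ : Lsl2, hF.gradR x ξ = trc b.1 ξ.1) (_ : ∀ ξ : Lsl2, hG.gradL x ξ = trc c.1 ξ.1)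
      (_ : ∀ ξ : Lsl2, hG.gradR x ξ = trc d.1 ξ.1) (_ : ∀ ξ : Lsl2, hH.gradL x ξ = trc c'.1 ξ.1)
      (_ : ∀ ξ : Lsl2, hH.gradR x ξ = trc d'.1 ξ.1),
      genBracket q φ σ κ (fun x => F x.1) (genBracket q φ σ κ (fun x => G x.1)
        (fun x => H x.1)) x =
      hH.second x.1 (vel x.1 (hamL q φ κ a b) (hamR q φ σ κ a b)) (hamL q φ κ c d)
        (hamR q φ σ κ c d) -
      hG.second x.1 (vel x.1 (hamL q φ κ a b) (hamR q φ σ κ a b)) (hamL q φ κ c' d')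
        (hamR q φ σ κ c' d') := by
    intro F G H hF hG hH hd a b c d c' d' ha hb hc hd' hc' hd''
    have hE : ∀ y, IsRegular.bracketDeriv q φ σ κ hG hH x y =
        hG.second x.1 y (hamL q φ κ c' d') (hamR q φ σ κ c' d') -
        hH.second x.1 y (hamL q φ κ c d) (hamR q φ σ κ c d) := by
      intro y
      have hc := HasCoeffDeriv.line x.1 y
      have l₁ := (hG.hasLinDeriv_left hc).continuous
      have r₁ := (hG.hasLinDeriv_right hc).continuous
      have l₂ := (hH.hasLinDeriv_left hc).continuous
      have r₂ := (hH.hasLinDeriv_right hc).continuous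
      rw [add_zero_smul_lmat] at l₁ r₁ l₂ r₂
      rw [IsRegular.bracketDeriv, genPair_skew q φ σ κ (hG.gradL x),
        genPair_eq q hφ σ κ l₁ r₁ hc' hd'', genPair_eq q hφ σ κ l₂ r₂ ‹_› hd',
        hG.left_add_right, hH.left_add_right]
      ring
    rw [genBracket, (hF.isLeftGradient x).leftGrad_eq, (hF.isRightGradient x).rightGrad_eq,
      genPair_skew, genPair_eq q hφ σ κ (hd.left x).1 (hd.right x).1 ha hb,
      IsRegular.leftGrad_genBracket q φ σ κ hG hH hd, IsRegular.rightGrad_genBracket q φ σ κ hG hH hd,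
      hE, hE, vel, hG.second_add, hH.second_add]
    ring
  -- Collecting the two second derivatives of the same function leaves a commutator.
  have swap : ∀ {F : LMat → ℂ} (hF : IsRegular F) (a b : Lsl2)
      (_ : ∀ ξ : Lsl2, hF.gradL x ξ = trc a.1 ξ.1) (_ : ∀ ξ : Lsl2, hF.gradR x ξ = trc b.1 ξ.1)
      (u v u' v' : Lsl2),
      hF.second x.1 (vel x.1 u v) u' v' - hF.second x.1 (vel x.1 u' v') u v =
        brTrc a u' u - brTrc b v' v := by
    intro F hF a b ha hb u v u' v'
    rw [hF.second_sub, brTrc_swap b, sub_neg_eq_add]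
    exact congrArg₂ (· + ·) (ha (lsl2Br u' u)) (hb (lsl2Br v v'))
  have hab : brTrc a₁ a₂ a₃ = brTrc b₁ b₂ b₃ := by
    rw [hab₁, hab₂, hab₃, brTrc_adLie]
  have key := sum_brTrc_ham h q φ a₁ a₂ a₃ b₁ b₂ b₃ hab
  simp only [Pi.add_apply, Pi.zero_apply]
  rw [nested hF₁ hF₂ hF₃ d₂₃ a₁ b₁ a₂ b₂ a₃ b₃ ha₁ hb₁ ha₂ hb₂ ha₃ hb₃,
    nested hF₂ hF₃ hF₁ d₃₁ a₂ b₂ a₃ b₃ a₁ b₁ ha₂ hb₂ ha₃ hb₃ ha₁ hb₁,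
    nested hF₃ hF₁ hF₂ d₁₂ a₃ b₃ a₁ b₁ a₂ b₂ ha₃ hb₃ ha₁ hb₁ ha₂ hb₂]
  have s₁ := swap hF₁ a₁ b₁ ha₁ hb₁ (hamL q φ κ a₂ b₂) (hamR q φ σ κ a₂ b₂)
    (hamL q φ κ a₃ b₃) (hamR q φ σ κ a₃ b₃)
  have s₂ := swap hF₂ a₂ b₂ ha₂ hb₂ (hamL q φ κ a₃ b₃) (hamR q φ σ κ a₃ b₃)
    (hamL q φ κ a₁ b₁) (hamR q φ σ κ a₁ b₁)
  have s₃ := swap hF₃ a₃ b₃ ha₃ hb₃ (hamL q φ κ a₁ b₁) (hamR q φ σ κ a₁ b₁)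
    (hamL q φ κ a₂ b₂) (hamR q φ σ κ a₂ b₂)
  rw [brTrc_swap a₁, brTrc_swap b₁] at s₁
  rw [brTrc_swap a₂, brTrc_swap b₂] at s₂
  rw [brTrc_swap a₃, brTrc_swap b₃] at s₃
  linear_combination s₁ + s₂ + s₃ - key

end jacobi

theorem genBracket_isPoisson {σ κ : ℂ} (h : σ = -1 ∧ κ = 0 ∨ σ = 1 ∧ κ = 1) (q : ℂˣ) {φ : ℤ → ℂ}
    (hφ : ∀ n, φ n + φ (-n) = 1) : IsPoissonBracketOn functionals (genBracket q φ σ κ) where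
  mem f hf g hg := genBracket_mem q φ σ κ hf hg
  add_left f hf g hg h hh := genBracket_add_left q φ σ κ (isDifferentiable_of_mem hf)
    (isDifferentiable_of_mem hg) (isDifferentiable_of_mem hh)
  smul_left c f hf g hg := genBracket_smul_left q φ σ κ c (isDifferentiable_of_mem hf)
    (isDifferentiable_of_mem hg)
  skew f _ g _ := genBracket_skew q φ σ κ f g
  leibniz f hf g hg h hh := by
    rw [genBracket_skew, genBracket_mul_left q φ σ κ (isDifferentiable_of_mem hg)
      (isDifferentiable_of_mem hh) (isDifferentiable_of_mem hf), genBracket_skew q φ σ κ f g,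
      genBracket_skew q φ σ κ f h]
    ring
  jacobi f hf g hg h' hh := genBracket_jacobi h q hφ hf hg hh

end QLoop

end

theorem mainTheorem9 (q : ℂˣ) (φ : ℤ → ℂ) (hφ : ∀ n, φ n + φ (-n) = 1) :
    -- the functionals have gradients, so that the brackets are meaningful on them
    (∀ f ∈ QLoop.functionals, QLoop.IsDifferentiable f) ∧
    -- `(LSL₂, η)` is a Poisson-Lie group
    (QLoop.IsPoissonBracketOn QLoop.functionals (QLoop.etaBracket φ) ∧
      QLoop.IsPoissonMap (QLoop.etaBracket φ) (QLoop.etaBracket φ) (QLoop.etaBracket φ)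
        (fun g h => g * h)) ∧
    -- `η_*^q` is a Poisson structure on `M_{2,q}`
    QLoop.IsPoissonBracketOn QLoop.functionals (QLoop.etaStarBracket q φ) ∧
    -- the `q`-gauge action is an action, and it is Poisson
    ((∀ M, QLoop.qGauge q 1 M = M) ∧
      (∀ g h M, QLoop.qGauge q (g * h) M = QLoop.qGauge q g (QLoop.qGauge q h M)) ∧
      QLoop.IsPoissonMap (QLoop.etaBracket φ) (QLoop.etaStarBracket q φ)
        (QLoop.etaStarBracket q φ) (QLoop.qGauge q)) ∧
    -- `LN` is admissible
    QLoop.IsAdmissible q (QLoop.etaStarBracket q φ) QLoop.LN := by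
  refine ⟨fun f hf => QLoop.isDifferentiable_of_mem hf, ⟨?_, QLoop.isPoissonMap_mul φ⟩, ?_,
    ⟨QLoop.qGauge_one q, QLoop.qGauge_mul q, QLoop.isPoissonMap_qGauge q hφ⟩,
    QLoop.isAdmissible_LN q hφ⟩
  · rw [QLoop.etaBracket_eq]
    exact QLoop.genBracket_isPoisson (.inl ⟨rfl, rfl⟩) 1 hφ
  · rw [QLoop.etaStarBracket_eq]
    exact QLoop.genBracket_isPoisson (.inr ⟨rfl, rfl⟩) q hφ
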